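/- Theorem. Let $1\le r\le n$ be integers and let $\Sigma^n$ be a connected, complete, smooth $n$-dimensional Riemannian manifold (without boundary) with a smooth isometric immersion $X\colon\Sigma^n\to\mathbb R^{n+1}$, not assumed proper, and a continuous globally defined unit normal vector field $N$. Let $A$ be the shape operator, $A(Y)=-\overline\nabla_Y N$ (where $\overline\nabla$ is the Levi-Civita connection of $\mathbb R^{n+1}$), let $k_1,\dots,k_n$ be its eigenvalues, let $\sigma_j$ be the $j$-th elementary symmetric function of $k_1,\dots,k_n$ ($\sigma_0=1$), and let $P_{r-1}=\sum_{j=0}^{r-1}(-1)^j\sigma_{r-1-j}A^j$ be the $(r-1)$-th Newton transformation. Suppose that $\Sigma^n$ is a self-shrinker of the $r$-mean curvature flow, i.e. $$\sigma_r=-\langle X,N\rangle\quad\text{on }\Sigma^n,$$ and that $P_{r-1}$ is positive semidefinite at every point. Write $\sqrt{P_{r-1}}$ for its positive semidefinite square root and $\|T\|^2=\operatorname{tr}(T^{t}T)$. If $$\sup_{\Sigma^n}\|A\|^2<\infty\qquad\text{and}\qquad\sup_{\Sigma^n}\|\sqrt{P_{r-1}}\,A\|^2<r,$$ then $\Sigma^n$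 is a hyperplane of $\mathbb R^{n+1}$: $X$ is an isometry of $\Sigma^n$ (with its Riemannian distance) onto an $n$-dimensional linear subspace of $\mathbb R^{n+1}$. -/

import Mathlib

open scoped Manifold ContDiff Bundle InnerProductSpace

noncomputable section

namespace SelfShrinker

section LinearAlgebra

variable {V : Type*} [NormedAddCommGroup V] [InnerProductSpace ℝ V] [FiniteDimensional ℝ V]

/-- The eigenvalues of an endomorphism, listed with multiplicity, as the roots of its
characteristic polynomial (a symmetric endomorphism has `dim V` of them). -/
def eigenvalues (A : V →ₗ[ℝ] V) : Multiset ℝ := A.charpoly.roots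

/-- The `r`-th elementary symmetric function `σ_r` of the eigenvalues of `A`;
`σ_0 = 1`, and `σ_r = 0` for `r > dim V`. -/
def sigma (A : V →ₗ[ℝ] V) (r : ℕ) : ℝ := (eigenvalues A).esymm r

/-- The Newton transformation `P_r = ∑_{j ≤ r} (-1)^j σ_{r-j} A^j`. -/
def newton (A : V →ₗ[ℝ] V) (r : ℕ) : V →ₗ[ℝ] V :=
  ∑ j ∈ Finset.range (r + 1), ((-1 : ℝ) ^ j * sigma A (r - j)) • A ^ j

/-- The squared trace (Hilbert-Schmidt) norm `‖T‖² = tr (Tᵗ T)`. -/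
def traceNormSq (T : V →ₗ[ℝ] V) : ℝ :=
  LinearMap.trace ℝ V (LinearMap.adjoint T ∘ₗ T)

theorem exists_sqrt (P : V →ₗ[ℝ] V) (hP : P.IsPositive) :
    ∃ S : V →ₗ[ℝ] V, S.IsPositive ∧ S ∘ₗ S = P := by
  set b := hP.isSymmetric.eigenvectorBasis rfl
  set l := hP.isSymmetric.eigenvalues rfl
  have hl : ∀ i, 0 ≤ l i := fun i => hP.nonneg_eigenvalues rfl i
  have hb : ∀ i, P (b i) = l i • b i := fun i => hP.isSymmetric.apply_eigenvectorBasis rfl i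
  set S : V →ₗ[ℝ] V := b.toBasis.constr ℝ fun i => Real.sqrt (l i) • b i
  have hS : ∀ i, S (b i) = Real.sqrt (l i) • b i := fun i => by
    have := b.toBasis.constr_basis ℝ (fun i => Real.sqrt (l i) • b i) i
    rwa [OrthonormalBasis.coe_toBasis] at this
  have hrep : ∀ v w, ⟪S v, w⟫_ℝ = ∑ i, Real.sqrt (l i) * (⟪b i, v⟫_ℝ * ⟪b i, w⟫_ℝ) := by
    intro v w
    conv_lhs => rw [← b.sum_repr' v]
    simp only [map_sum, map_smul, hS, sum_inner, inner_smul_left]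
    refine Finset.sum_congr rfl fun i _ => ?_
    simp; ring
  refine ⟨S, ⟨fun v w => ?_, fun v => ?_⟩, b.toBasis.ext fun i => ?_⟩
  · rw [hrep, real_inner_comm, hrep]
    exact Finset.sum_congr rfl fun i _ => by ring
  · simp only [RCLike.re_to_real, hrep]
    exact Finset.sum_nonneg fun i _ => mul_nonneg (Real.sqrt_nonneg _) (mul_self_nonneg _)
  · simp [hS, hb, smul_smul, Real.mul_self_sqrt (hl i)]

open Classical in
/-- The square root `√P` of a positive semidefinite `P`: the positive semidefinite endomorphism
whose square is `P` (it exists by `exists_sqrt`; the value is `0` if `P` is not positive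
semidefinite). -/
def sqrtEnd (P : V →ₗ[ℝ] V) : V →ₗ[ℝ] V :=
  if hP : P.IsPositive then (exists_sqrt P hP).choose else 0

end LinearAlgebra

section Hypersurface

/-- The Euclidean space `ℝᵏ`. -/
abbrev E (k : ℕ) : Type := EuclideanSpace ℝ (Fin k)

variable {n : ℕ} {M : Type*} [TopologicalSpace M] [ChartedSpace (E n) M]

instance (x : M) : FiniteDimensional ℝ (TangentSpace (𝓡 n) x) :=
  inferInstanceAs (FiniteDimensional ℝ (E n))

/-- The differential at `x` of a map `F` from the `n`-manifold `M` to `ℝᵏ`. -/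
def differential {k : ℕ} (F : M → E k) (x : M) : TangentSpace (𝓡 n) x →ₗ[ℝ] E k :=
  (NormedSpace.fromTangentSpace (F x)).toLinearMap ∘ₗ
    (mfderiv (𝓡 n) 𝓘(ℝ, E k) F x).toLinearMap

variable [Bundle.RiemannianBundle (fun x : M => TangentSpace (𝓡 n) x)]

/-- `X` is a smooth isometric immersion of the Riemannian `n`-manifold `M` into `ℝⁿ⁺¹`. -/
structure IsIsometricImmersion (X : M → E (n + 1)) : Prop where
  smooth : ContMDiff (𝓡 n) 𝓘(ℝ, E (n + 1)) ∞ X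
  isometric : ∀ (x : M) (v w : TangentSpace (𝓡 n) x),
    ⟪differential X x v, differential X x w⟫_ℝ = ⟪v, w⟫_ℝ

/-- `N` is a continuous globally defined unit normal vector field along `X`. -/
structure IsUnitNormal (X N : M → E (n + 1)) : Prop where
  continuous : Continuous N
  norm_eq_one : ∀ x, ‖N x‖ = 1
  orthogonal : ∀ (x : M) (v : TangentSpace (𝓡 n) x), ⟪differential X x v, N x⟫_ℝ = 0

/-- The shape operator `A` of `X` with respect to `N`, i.e. `A v = -∇̄_v N`, viewed in the
tangent space through `dX`: it is the endomorphism with `⟪A v, w⟫ = -⟪dN v, dX w⟫`. -/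
def shape (X N : M → E (n + 1)) (x : M) :
    TangentSpace (𝓡 n) x →ₗ[ℝ] TangentSpace (𝓡 n) x :=
  -((LinearMap.adjoint (𝕜 := ℝ) (E := TangentSpace (𝓡 n) x) (F := E (n + 1))
    (differential X x)) ∘ₗ differential N x)

/-- The self-shrinker equation `σ_r = -⟪X, N⟫` of the `r`-mean curvature flow. -/
def IsSelfShrinker (r : ℕ) (X N : M → E (n + 1)) : Prop :=
  ∀ x, sigma (shape X N x) r = -⟪X x, N x⟫_ℝ

end Hypersurface

end SelfShrinker

end

/-! Write u = ⟨X, N⟩ and P = P_{r-1}, and let X^T be the tangential part of X. Differentiating u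
twice, using the Codazzi equation and substituting σ_r = -u gives tr(P Hess u) = ⟨∇u, X^T⟩ + (r -
‖√P A‖²) u. By hypothesis the bracket is at least some ε > 0, and P ≥ 0, so at a maximum of u² the
second derivative test, weighted by the eigenvalues of P, forces u = 0. Only P ≥ 0 is needed,
because the test is applied separately in each eigendirection of A.

A maximum need not exist, and X need not be proper, so u² is replaced by u² - η|X|² - η|X - X(p)|².
Here p nearly maximizes u² - η|X|². Since A is bounded, the hypersurface is a graph over a ball of
fixed radius around p, and the last term forces an interior maximum there
(`exists_isLocalMax_penalized`). The penalty is compatible with the unbounded drift X^T: its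
contribution 2η(|X^T|² + ⟨X^T, (X - X(p))^T⟩) is bounded below by completing the square. At such a
maximum u² = O(η) (`support_sq_le_of_isLocalMax`), and η → 0 gives u = 0 everywhere
(`inner_position_normal_eq_zero`).

Once u = 0 the hypersurface is infinitesimally a cone, A is homogeneous of degree -1, and ⟨∇‖A‖²,
X^T⟩ = -2‖A‖². The first order condition at a penalized maximum of ‖A‖² then gives ‖A‖² ≤ η, hence A
= 0 (`trace_sq_le_of_isLocalMax`, `shape_eq_zero`). Thus N is constant, and projection to the
orthogonal hyperplane is a local isometry. Completeness lets segments lift through it, which makes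
it a global isometry (`isometry_and_range_eq`).

All calculus is done in graph coordinates over the tangent hyperplane at the point considered, where
A is the derivative of ∇f/√(1+|∇f|²). -/

noncomputable section

namespace SelfShrinker

/-! ### Elementary symmetric functions and derivatives of characteristic polynomials. -/

section NewtonAlgebra

open Polynomial

/-- The value at `x` of the polynomial `∑ (-1)^j e_{k-j}(s) x^j`; for `x ∈ s` this is the `k`-th
elementary symmetric function of `s` with `x` removed. -/
def newtonValue (s : Multiset ℝ) (k : ℕ) (x : ℝ) : ℝ :=
  ∑ j ∈ Finset.range (k + 1), (-1 : ℝ) ^ j * s.esymm (k - j) * x ^ j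

theorem esymm_zero (s : Multiset ℝ) : s.esymm 0 = 1 := by
  simp [Multiset.esymm]

theorem esymm_cons_succ (x : ℝ) (s : Multiset ℝ) (k : ℕ) :
    (x ::ₘ s).esymm (k + 1) = s.esymm (k + 1) + x * s.esymm k := by
  simp only [Multiset.esymm, Multiset.powersetCard_cons, Multiset.map_add, Multiset.sum_add,
    Multiset.map_map, Function.comp_def, Multiset.prod_cons, Multiset.sum_map_mul_left]

theorem newtonValue_succ (s : Multiset ℝ) (k : ℕ) (x : ℝ) :
    newtonValue s (k + 1) x = s.esymm (k + 1) - x * newtonValue s k x := by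
  unfold newtonValue
  rw [Finset.sum_range_succ', Finset.mul_sum, sub_eq_add_neg, ← Finset.sum_neg_distrib, add_comm]
  congr 1
  · simp
  · refine Finset.sum_congr rfl fun j _ => ?_
    rw [Nat.add_sub_add_right]
    ring

/-- Both sides satisfy the same recursion in k, since e_{k+1}(s) = e_{k+1}(x, s) - x e_k(s). -/
theorem newtonValue_cons (x : ℝ) (s : Multiset ℝ) (k : ℕ) :
    newtonValue (x ::ₘ s) k x = s.esymm k := by
  induction k with
  | zero => simp [newtonValue, esymm_zero]
  | succ k ih => rw [newtonValue_succ, ih, esymm_cons_succ]; ring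

theorem newtonValue_map_univ {ι : Type*} [Fintype ι] [DecidableEq ι] (l : ι → ℝ) (k : ℕ) (i : ι) :
    newtonValue (Finset.univ.val.map l) k (l i) =
      ((Finset.univ.erase i).val.map l).esymm k := by
  rw [← newtonValue_cons (l i)]
  congr 1
  rw [← Multiset.map_cons, ← Finset.insert_val_of_notMem (Finset.notMem_erase i _),
    Finset.insert_erase (Finset.mem_univ i)]

/-- Newton's identity: `∑ᵢ e_k(l without lᵢ) lᵢ = (k + 1) e_{k+1}(l)`. -/
theorem sum_newtonValue_mul {ι : Type*} [Fintype ι] (l : ι → ℝ) (k : ℕ) :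
    ∑ i, newtonValue (Finset.univ.val.map l) k (l i) * l i =
      (k + 1) * (Finset.univ.val.map l).esymm (k + 1) := by
  have h := congrArg (MvPolynomial.aeval l) (MvPolynomial.mul_esymm_eq_sum ι ℝ (k + 1))
  simp only [map_mul, map_natCast, map_pow, map_neg, map_one, map_sum,
    MvPolynomial.aeval_esymm_eq_multiset_esymm, MvPolynomial.psum, MvPolynomial.aeval_X] at h
  push_cast at h
  rw [h, Finset.sum_filter, Finset.Nat.sum_antidiagonal_eq_sum_range_succ_mk,
    Finset.sum_range_succ]
  simp only [lt_irrefl, if_false, add_zero]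
  unfold newtonValue
  simp only [Finset.sum_mul]
  rw [Finset.sum_comm, ← Finset.sum_range_reflect, Finset.mul_sum]
  refine Finset.sum_congr rfl fun j hj => ?_
  have hj' : j < k + 1 := Finset.mem_range.1 hj
  obtain ⟨m, rfl⟩ : ∃ m, k = j + m := ⟨k - j, by omega⟩
  have e1 : j + m + 1 - 1 - j = m := by omega
  have e2 : j + m - m = j := by omega
  have e3 : j + m + 1 - j = m + 1 := by omega
  rw [if_pos hj', e1, e2, e3, Finset.mul_sum, Finset.mul_sum]
  refine Finset.sum_congr rfl fun i _ => ?_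
  have : (-1 : ℝ) ^ (j + m + 1 + 1) * (-1) ^ j = (-1) ^ m := by
    rw [← pow_add, show j + m + 1 + 1 + j = m + 2 * (j + 1) by ring, pow_add, pow_mul]
    simp
  rw [← this]
  ring

/-- Lagrange interpolation at the nodes 0, …, N-1. The weights do not depend on the polynomial, so
derivatives of values become derivatives of coefficients. -/
theorem coeff_eq_sum_eval {N : ℕ} {p : ℝ[X]} (hp : p.degree < (N : ℕ)) (k : ℕ) :
    p.coeff k = ∑ i : Fin N, p.eval (i : ℝ) *
      (Lagrange.basis Finset.univ (fun j : Fin N => ((j : ℕ) : ℝ)) i).coeff k := by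
  have hinj : Set.InjOn (fun j : Fin N => ((j : ℕ) : ℝ)) (Finset.univ : Finset (Fin N)) := by
    intro i _ j _ h
    exact Fin.ext (by simpa using h)
  conv_lhs => rw [Lagrange.eq_interpolate (s := Finset.univ) hinj (f := p) (by simpa using hp),
    Lagrange.interpolate_apply, finsetSum_coeff]
  simp

theorem hasDerivAt_coeff {N : ℕ} {p : ℝ → ℝ[X]} {q : ℝ[X]} {t₀ : ℝ}
    (hp : ∀ t, (p t).degree < (N : ℕ)) (hq : q.degree < (N : ℕ))
    (h : ∀ z : ℝ, HasDerivAt (fun t => (p t).eval z) (q.eval z) t₀) (k : ℕ) :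
    HasDerivAt (fun t => (p t).coeff k) (q.coeff k) t₀ := by
  rw [coeff_eq_sum_eval hq k]
  simp_rw [fun t => coeff_eq_sum_eval (hp t) k]
  exact HasDerivAt.fun_sum fun i _ => (h _).mul_const _

/-- A permutation other than the identity moves at least two indices. After one factor is
differentiated, a vanishing off-diagonal entry remains, so only the identity contributes. -/
theorem hasDerivAt_det_of_diagonal {ι : Type*} [Fintype ι] [DecidableEq ι]
    {M : ℝ → Matrix ι ι ℝ} {d : ι → ℝ} {T : Matrix ι ι ℝ} {t₀ : ℝ}
    (hM : M t₀ = Matrix.diagonal d) (h : ∀ i j, HasDerivAt (fun t => M t i j) (T i j) t₀) :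
    HasDerivAt (fun t => (M t).det) (∑ i, (∏ j ∈ Finset.univ.erase i, d j) * T i i) t₀ := by
  simp_rw [Matrix.det_apply']
  have key : ∀ σ : Equiv.Perm ι, HasDerivAt
      (fun t => ((Equiv.Perm.sign σ : ℤ) : ℝ) * ∏ i, M t (σ i) i)
      (((Equiv.Perm.sign σ : ℤ) : ℝ) *
        ∑ i, (∏ j ∈ Finset.univ.erase i, M t₀ (σ j) j) • T (σ i) i) t₀ :=
    fun σ => (HasDerivAt.fun_finsetProd fun i _ => h (σ i) i).const_mul _
  have hs := HasDerivAt.fun_sum (u := Finset.univ) fun σ _ => key σ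
  refine hs.congr_deriv ?_
  rw [Finset.sum_eq_single (1 : Equiv.Perm ι)]
  · simp [hM]
  · intro σ _ hσ
    refine mul_eq_zero_of_right _ (Finset.sum_eq_zero fun i _ => ?_)
    obtain ⟨j, hji, hj⟩ : ∃ j, j ≠ i ∧ σ j ≠ j := by
      by_contra hcon
      push Not at hcon
      refine hσ (Equiv.ext fun j => ?_)
      by_cases hji : j = i
      · subst hji
        by_contra hne
        have h1 := hcon (σ j) (by simpa using hne)
        exact hne (by simpa using h1)
      · exact hcon j hji
    rw [Finset.prod_eq_zero (Finset.mem_erase.2 ⟨hji, Finset.mem_univ j⟩), zero_smul]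
    rw [hM, Matrix.diagonal_apply_ne _ hj]
  · simp

theorem hasDerivAt_charpoly_coeff_of_diagonal {ι : Type*} [Fintype ι] [DecidableEq ι]
    {M : ℝ → Matrix ι ι ℝ} {l : ι → ℝ} {T : Matrix ι ι ℝ} {t₀ : ℝ}
    (hM : M t₀ = Matrix.diagonal l) (h : ∀ i j, HasDerivAt (fun t => M t i j) (T i j) t₀) (k : ℕ) :
    HasDerivAt (fun t => (M t).charpoly.coeff k)
      ((∑ i, (∏ j ∈ Finset.univ.erase i, (X - C (l j))) * C (-T i i)).coeff k) t₀ := by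
  refine hasDerivAt_coeff (N := Fintype.card ι + 1) (fun t => ?_) ?_ (fun z => ?_) k
  · rw [Matrix.charpoly_degree_eq_dim]
    exact_mod_cast Nat.lt_succ_self _
  · refine lt_of_le_of_lt (degree_sum_le _ _) ?_
    rw [Finset.sup_lt_iff (WithBot.bot_lt_coe _)]
    intro i _
    refine lt_of_le_of_lt (degree_mul_le _ _) ?_
    have h1 : (∏ j ∈ Finset.univ.erase i, (X - C (l j))).degree ≤
        ((Fintype.card ι : ℕ) : WithBot ℕ) := by
      rw [degree_prod]
      simp only [degree_X_sub_C, Finset.sum_const, nsmul_eq_mul, mul_one]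
      exact_mod_cast (Finset.card_le_univ _)
    calc _ ≤ ((Fintype.card ι : ℕ) : WithBot ℕ) + 0 := add_le_add h1 degree_C_le
      _ < _ := by
        rw [add_zero]
        exact_mod_cast Nat.lt_succ_self _
  · simp_rw [Matrix.eval_charpoly]
    have hd : Matrix.scalar ι z - M t₀ = Matrix.diagonal fun i => z - l i := by
      rw [hM, Matrix.scalar_apply, Matrix.diagonal_sub]
    have hT : ∀ i j, HasDerivAt (fun t => (Matrix.scalar ι z - M t) i j) ((-T) i j) t₀ :=
      fun i j => by simpa using (h i j).const_sub _
    refine (hasDerivAt_det_of_diagonal hd hT).congr_deriv ?_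
    simp [eval_finsetSum, eval_prod]

/-- Vieta for the product with one root removed. Its degree is one less than the cardinality, so
this coefficient carries e_k of the remaining roots, not e_{k+1}. -/
theorem coeff_prod_erase {ι : Type*} [Fintype ι] [DecidableEq ι] (l : ι → ℝ) (i : ι) {k : ℕ}
    (hk : k + 1 ≤ Fintype.card ι) :
    (∏ j ∈ Finset.univ.erase i, (X - C (l j))).coeff (Fintype.card ι - (k + 1)) =
      (-1) ^ k * newtonValue (Finset.univ.val.map l) k (l i) := by
  rw [newtonValue_map_univ]
  set s := (Finset.univ.erase i).val.map l
  have hs : Multiset.card s = Fintype.card ι - 1 := by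
    simp [s]
  have := Multiset.prod_X_sub_C_coeff s (k := Fintype.card ι - (k + 1)) (by omega)
  rw [hs, show Fintype.card ι - 1 - (Fintype.card ι - (k + 1)) = k by omega] at this
  rw [← this, Finset.prod, Multiset.map_map]
  rfl

end NewtonAlgebra

/-! ### Newton transformations and norms of symmetric endomorphisms. -/

section Symmetric

variable {V : Type*} [NormedAddCommGroup V] [InnerProductSpace ℝ V]

theorem trace_sq_congr {W : Type*} [NormedAddCommGroup W] [InnerProductSpace ℝ W]
    {A : V →ₗ[ℝ] V} {B : W →ₗ[ℝ] W} (e : V ≃ₗ[ℝ] W) (h : ∀ v, e (A v) = B (e v)) :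
    LinearMap.trace ℝ V (A ∘ₗ A) = LinearMap.trace ℝ W (B ∘ₗ B) := by
  have : e.conj (A ∘ₗ A) = B ∘ₗ B := by
    ext w
    simp [LinearEquiv.conj_apply, h]
  rw [← this, LinearMap.trace_conj']

variable [FiniteDimensional ℝ V]

/-- `sigma` is built from the real roots, and Vieta's formula sees it as a coefficient only when the
polynomial splits. This gives access to derivatives without differentiating eigenvalues. -/
theorem sigma_eq_coeff {A : V →ₗ[ℝ] V} (hA : A.charpoly.Splits) {k : ℕ}
    (hk : k ≤ Module.finrank ℝ V) :
    sigma A k = (-1) ^ k * A.charpoly.coeff (Module.finrank ℝ V - k) := by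
  have hd : A.charpoly.natDegree = Module.finrank ℝ V := A.charpoly_natDegree
  rw [Polynomial.coeff_eq_esymm_roots_of_splits hA (by rw [hd]; omega), hd,
    A.charpoly_monic.leadingCoeff, show Module.finrank ℝ V - (Module.finrank ℝ V - k) = k by omega,
    sigma, eigenvalues, one_mul, ← mul_assoc, ← mul_pow]
  simp

theorem sigma_congr {W : Type*} [NormedAddCommGroup W] [InnerProductSpace ℝ W]
    [FiniteDimensional ℝ W] {A : V →ₗ[ℝ] V} {B : W →ₗ[ℝ] W} (e : V ≃ₗ[ℝ] W)
    (h : ∀ v, e (A v) = B (e v)) (k : ℕ) : sigma A k = sigma B k := by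
  have : e.conj A = B := by
    ext w
    simp [LinearEquiv.conj_apply, h]
  rw [sigma, sigma, eigenvalues, eigenvalues, ← this, LinearEquiv.charpoly_conj]

theorem splits_charpoly_congr {W : Type*} [NormedAddCommGroup W] [InnerProductSpace ℝ W]
    [FiniteDimensional ℝ W] {A : V →ₗ[ℝ] V} {B : W →ₗ[ℝ] W} (e : V ≃ₗ[ℝ] W)
    (h : ∀ v, e (A v) = B (e v)) (hA : A.charpoly.Splits) : B.charpoly.Splits := by
  have : e.conj A = B := by
    ext w
    simp [LinearEquiv.conj_apply, h]
  rwa [← this, LinearEquiv.charpoly_conj]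

variable {ι : Type*} [Fintype ι]

/-- First variation of `σ_{k+1}` at an endomorphism that is diagonal in an orthonormal basis. -/
theorem hasDerivAt_sigma (b : OrthonormalBasis ι ℝ V) {B : ℝ → V →ₗ[ℝ] V} {l : ι → ℝ}
    {T : V →ₗ[ℝ] V} {t₀ : ℝ}
    (hl : ∀ i, B t₀ (b i) = l i • b i)
    (hT : ∀ i j, HasDerivAt (fun t => ⟪b i, B t (b j)⟫_ℝ) ⟪b i, T (b j)⟫_ℝ t₀)
    (hs : ∀ᶠ t in nhds t₀, (B t).charpoly.Splits) {k : ℕ} (hk : k + 1 ≤ Module.finrank ℝ V) :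
    HasDerivAt (fun t => sigma (B t) (k + 1))
      (∑ i, newtonValue (Finset.univ.val.map l) k (l i) * ⟪b i, T (b i)⟫_ℝ) t₀ := by
  classical
  have hcard : Module.finrank ℝ V = Fintype.card ι := Module.finrank_eq_card_basis b.toBasis
  have hM : LinearMap.toMatrix b.toBasis b.toBasis (B t₀) = Matrix.diagonal l := by
    ext i j
    rw [LinearMap.toMatrix_apply, OrthonormalBasis.coe_toBasis, hl,
      OrthonormalBasis.coe_toBasis_repr_apply, OrthonormalBasis.repr_apply_apply, inner_smul_right,
      orthonormal_iff_ite.1 b.orthonormal, Matrix.diagonal_apply]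
    split_ifs with h <;> simp [h]
  have hMT : ∀ i j, HasDerivAt (fun t => LinearMap.toMatrix b.toBasis b.toBasis (B t) i j)
      (LinearMap.toMatrix b.toBasis b.toBasis T i j) t₀ := by
    intro i j
    simpa only [LinearMap.toMatrix_apply, OrthonormalBasis.coe_toBasis,
      OrthonormalBasis.coe_toBasis_repr_apply, OrthonormalBasis.repr_apply_apply] using hT i j
  have hd := (hasDerivAt_charpoly_coeff_of_diagonal hM hMT
    (Fintype.card ι - (k + 1))).const_mul ((-1 : ℝ) ^ (k + 1))
  refine (hd.congr_deriv ?_).congr_of_eventuallyEq ?_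
  · rw [Polynomial.finsetSum_coeff, Finset.mul_sum]
    refine Finset.sum_congr rfl fun i _ => ?_
    rw [Polynomial.coeff_mul_C, coeff_prod_erase l i (hcard ▸ hk), LinearMap.toMatrix_apply,
      OrthonormalBasis.coe_toBasis, OrthonormalBasis.coe_toBasis_repr_apply,
      OrthonormalBasis.repr_apply_apply, pow_succ]
    have : (-1 : ℝ) ^ k * (-1) ^ k = 1 := by rw [← mul_pow]; simp
    linear_combination newtonValue (Finset.univ.val.map l) k (l i) * ⟪b i, T (b i)⟫_ℝ * this
  · filter_upwards [hs] with t ht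
    rw [sigma_eq_coeff ht hk, hcard, LinearMap.charpoly_toMatrix]

variable {A : V →ₗ[ℝ] V} {n : ℕ}

theorem sigma_eq_esymm (hA : A.IsSymmetric) (hn : Module.finrank ℝ V = n) (k : ℕ) :
    sigma A k = (Finset.univ.val.map (hA.eigenvalues hn)).esymm k := by
  rw [sigma, eigenvalues, hA.roots_charpoly_eq_eigenvalues hn]
  rfl

theorem newton_apply_eigenvectorBasis (hA : A.IsSymmetric) (hn : Module.finrank ℝ V = n) (k : ℕ)
    (i : Fin n) :
    newton A k (hA.eigenvectorBasis hn i) =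
      newtonValue (Finset.univ.val.map (hA.eigenvalues hn)) k (hA.eigenvalues hn i) •
        hA.eigenvectorBasis hn i := by
  have hpow : ∀ j, (A ^ j) (hA.eigenvectorBasis hn i) =
      (hA.eigenvalues hn i) ^ j • hA.eigenvectorBasis hn i := by
    intro j
    induction j with
    | zero => simp
    | succ j ih =>
      rw [pow_succ', Module.End.mul_apply, ih, map_smul, hA.apply_eigenvectorBasis, smul_smul,
        pow_succ]
      rfl
  simp only [newton, newtonValue, LinearMap.sum_apply, LinearMap.smul_apply, hpow, smul_smul,
    Finset.sum_smul, sigma_eq_esymm hA hn]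

theorem newtonValue_nonneg (hA : A.IsSymmetric) (hn : Module.finrank ℝ V = n) {k : ℕ}
    (hP : (newton A k).IsPositive) (i : Fin n) :
    0 ≤ newtonValue (Finset.univ.val.map (hA.eigenvalues hn)) k (hA.eigenvalues hn i) := by
  have h := hP.2 (hA.eigenvectorBasis hn i)
  rw [newton_apply_eigenvectorBasis hA hn, inner_smul_left] at h
  simpa using h

theorem traceNormSq_eq_sum (b : OrthonormalBasis ι ℝ V) (T : V →ₗ[ℝ] V) :
    traceNormSq T = ∑ i, ⟪T (b i), T (b i)⟫_ℝ := by
  rw [traceNormSq, LinearMap.trace_eq_sum_inner _ b]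
  simp [LinearMap.adjoint_inner_right]

theorem traceNormSq_of_isSymmetric (hA : A.IsSymmetric) :
    traceNormSq A = LinearMap.trace ℝ V (A ∘ₗ A) := by
  rw [traceNormSq, LinearMap.isSelfAdjoint_iff'.1
    ((LinearMap.isSymmetric_iff_isSelfAdjoint A).1 hA)]

theorem traceNormSq_eq_sum_eigenvalues_sq (hA : A.IsSymmetric) (hn : Module.finrank ℝ V = n) :
    traceNormSq A = ∑ i, hA.eigenvalues hn i ^ 2 := by
  rw [traceNormSq_eq_sum (hA.eigenvectorBasis hn)]
  refine Finset.sum_congr rfl fun i _ => ?_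
  rw [hA.apply_eigenvectorBasis, inner_smul_left, inner_smul_right]
  simp [pow_two]

theorem sqrtEnd_spec {P : V →ₗ[ℝ] V} (hP : P.IsPositive) :
    (sqrtEnd P).IsPositive ∧ sqrtEnd P ∘ₗ sqrtEnd P = P := by
  rw [sqrtEnd, dif_pos hP]
  exact (exists_sqrt P hP).choose_spec

/-- The left side is tr(P A²): the square root is symmetric, so only its square P enters, and P is
diagonal in an eigenbasis of A. -/
theorem traceNormSq_sqrt_newton_comp (hA : A.IsSymmetric) (hn : Module.finrank ℝ V = n) {k : ℕ}
    (hP : (newton A k).IsPositive) :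
    traceNormSq (sqrtEnd (newton A k) ∘ₗ A) =
      ∑ i, newtonValue (Finset.univ.val.map (hA.eigenvalues hn)) k (hA.eigenvalues hn i) *
        hA.eigenvalues hn i ^ 2 := by
  rw [traceNormSq_eq_sum (hA.eigenvectorBasis hn)]
  refine Finset.sum_congr rfl fun i _ => ?_
  have h := sqrtEnd_spec hP
  rw [LinearMap.comp_apply, h.1.isSymmetric, ← LinearMap.comp_apply, h.2,
    hA.apply_eigenvectorBasis, map_smul, newton_apply_eigenvectorBasis hA hn, inner_smul_left,
    inner_smul_right, inner_smul_right]
  simp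
  ring

/-- Adjoining one element multiplies the bound by at most 1 + C ≤ 2C. -/
theorem abs_esymm_le {s : Multiset ℝ} {C : ℝ} (hC : 1 ≤ C) (hs : ∀ x ∈ s, |x| ≤ C) (k : ℕ) :
    |s.esymm k| ≤ (2 * C) ^ Multiset.card s := by
  induction s using Multiset.induction_on generalizing k with
  | empty =>
    cases k with
    | zero => simp [esymm_zero]
    | succ k => simp [Multiset.esymm, Multiset.powersetCard_zero_right]
  | cons x s ih =>
    have hs' : ∀ y ∈ s, |y| ≤ C := fun y hy => hs y (Multiset.mem_cons_of_mem hy)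
    have hx : |x| ≤ C := hs x (Multiset.mem_cons_self x s)
    have hpos : 1 ≤ (2 * C) ^ Multiset.card s := one_le_pow₀ (by linarith)
    rw [Multiset.card_cons, pow_succ]
    cases k with
    | zero =>
      rw [esymm_zero, abs_one]
      nlinarith
    | succ k =>
      rw [esymm_cons_succ]
      have h1 := ih hs' (k + 1)
      have h2 := ih hs' k
      calc |s.esymm (k + 1) + x * s.esymm k| ≤ |s.esymm (k + 1)| + |x * s.esymm k| := abs_add_le _ _
        _ ≤ (2 * C) ^ Multiset.card s + C * (2 * C) ^ Multiset.card s := by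
          rw [abs_mul]
          gcongr
        _ ≤ _ := by nlinarith

/-- The crude constant follows from 2|λ| ≤ 1 + λ² and avoids square roots; only finiteness matters
later. -/
theorem eigenvalue_abs_le (hA : A.IsSymmetric) (hn : Module.finrank ℝ V = n) {L : ℝ}
    (hL : traceNormSq A ≤ L) (i : Fin n) : |hA.eigenvalues hn i| ≤ 1 + L := by
  have h1 : hA.eigenvalues hn i ^ 2 ≤ L := by
    refine le_trans ?_ hL
    rw [traceNormSq_eq_sum_eigenvalues_sq hA hn]
    exact Finset.single_le_sum (f := fun j => hA.eigenvalues hn j ^ 2)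
      (fun j _ => sq_nonneg _) (Finset.mem_univ i)
  rw [← sq_abs] at h1
  nlinarith [sq_nonneg (|hA.eigenvalues hn i| - 1), abs_nonneg (hA.eigenvalues hn i)]

theorem abs_sigma_le (hA : A.IsSymmetric) (hn : Module.finrank ℝ V = n) {L : ℝ}
    (hL0 : 0 ≤ L) (hL : traceNormSq A ≤ L) (k : ℕ) : |sigma A k| ≤ (2 * (1 + L)) ^ n := by
  rw [sigma_eq_esymm hA hn]
  have := abs_esymm_le (s := Finset.univ.val.map (hA.eigenvalues hn)) (C := 1 + L) (by linarith)
    (by simpa using eigenvalue_abs_le hA hn hL) k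
  simpa using this

theorem sum_newtonValue_le (hA : A.IsSymmetric) (hn : Module.finrank ℝ V = n) {L : ℝ}
    (hL0 : 0 ≤ L) (hL : traceNormSq A ≤ L) (k : ℕ) :
    ∑ i, newtonValue (Finset.univ.val.map (hA.eigenvalues hn)) k (hA.eigenvalues hn i) ≤
      n * (2 * (1 + L)) ^ n := by
  calc _ ≤ ∑ _i : Fin n, (2 * (1 + L)) ^ n := ?_
    _ = _ := by simp
  refine Finset.sum_le_sum fun i _ => ?_
  rw [newtonValue_map_univ]
  refine (le_abs_self _).trans ((abs_esymm_le (C := 1 + L) (by linarith) ?_ k).trans ?_)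
  · intro x hx
    obtain ⟨j, -, rfl⟩ := Multiset.mem_map.1 hx
    exact eigenvalue_abs_le hA hn hL j
  · refine pow_le_pow_right₀ (by linarith) ?_
    rw [Multiset.card_map, Finset.card_val]
    exact (Finset.card_le_univ _).trans (by simp)

end Symmetric

/-! ### Second order expansions along lines. -/

section Jets

open Filter Topology

variable {F : Type*} [NormedAddCommGroup F]

/-- `f` is twice differentiable at `0` with value `f₀`, velocity `f₁` and acceleration `f₂`. -/
def HasJet [NormedSpace ℝ F] (f : ℝ → F) (f₀ f₁ f₂ : F) : Prop :=
  f 0 = f₀ ∧ ∃ f' : ℝ → F, (∀ᶠ t in 𝓝 0, HasDerivAt f (f' t) t) ∧ f' 0 = f₁ ∧ HasDerivAt f' f₂ 0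

namespace HasJet

section NormedSpace

variable [NormedSpace ℝ F] {f g : ℝ → F} {f₀ f₁ f₂ g₀ g₁ g₂ : F}

theorem congr (hf : HasJet f f₀ f₁ f₂) (h₀ : f₀ = g₀) (h₁ : f₁ = g₁) (h₂ : f₂ = g₂) :
    HasJet f g₀ g₁ g₂ :=
  h₀ ▸ h₁ ▸ h₂ ▸ hf

theorem const (c : F) : HasJet (fun _ => c) c 0 0 :=
  ⟨rfl, fun _ => 0, .of_forall fun _ => hasDerivAt_const _ _, rfl, hasDerivAt_const _ _⟩

theorem add (hf : HasJet f f₀ f₁ f₂) (hg : HasJet g g₀ g₁ g₂) :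
    HasJet (fun t => f t + g t) (f₀ + g₀) (f₁ + g₁) (f₂ + g₂) := by
  obtain ⟨rfl, f', hf', rfl, hf2⟩ := hf
  obtain ⟨rfl, g', hg', rfl, hg2⟩ := hg
  exact ⟨rfl, fun t => f' t + g' t, by filter_upwards [hf', hg'] with t h1 h2 using h1.add h2,
    rfl, hf2.add hg2⟩

theorem sub (hf : HasJet f f₀ f₁ f₂) (hg : HasJet g g₀ g₁ g₂) :
    HasJet (fun t => f t - g t) (f₀ - g₀) (f₁ - g₁) (f₂ - g₂) := by
  obtain ⟨rfl, f', hf', rfl, hf2⟩ := hf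
  obtain ⟨rfl, g', hg', rfl, hg2⟩ := hg
  exact ⟨rfl, fun t => f' t - g' t, by filter_upwards [hf', hg'] with t h1 h2 using h1.sub h2,
    rfl, hf2.sub hg2⟩

theorem affine (a e : F) : HasJet (fun t : ℝ => a + t • e) a e 0 := by
  refine ⟨by simp, fun _ => e, .of_forall fun t => ?_, rfl, hasDerivAt_const _ _⟩
  simpa using ((hasDerivAt_id t).smul_const e).const_add a

end NormedSpace

theorem inner [InnerProductSpace ℝ F] {f g : ℝ → F} {f₀ f₁ f₂ g₀ g₁ g₂ : F}
    (hf : HasJet f f₀ f₁ f₂) (hg : HasJet g g₀ g₁ g₂) :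
    HasJet (fun t => ⟪f t, g t⟫_ℝ) ⟪f₀, g₀⟫_ℝ (⟪f₀, g₁⟫_ℝ + ⟪f₁, g₀⟫_ℝ)
      (⟪f₀, g₂⟫_ℝ + 2 * ⟪f₁, g₁⟫_ℝ + ⟪f₂, g₀⟫_ℝ) := by
  obtain ⟨rfl, f', hf', rfl, hf2⟩ := hf
  obtain ⟨rfl, g', hg', rfl, hg2⟩ := hg
  refine ⟨rfl, fun t => ⟪f t, g' t⟫_ℝ + ⟪f' t, g t⟫_ℝ, ?_, rfl, ?_⟩
  · filter_upwards [hf', hg'] with t h1 h2 using h1.inner ℝ h2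
  · exact ((hf'.self_of_nhds.inner ℝ hg2).add (hf2.inner ℝ hg'.self_of_nhds)).congr_deriv (by ring)

theorem mul {f g : ℝ → ℝ} {f₀ f₁ f₂ g₀ g₁ g₂ : ℝ}
    (hf : HasJet f f₀ f₁ f₂) (hg : HasJet g g₀ g₁ g₂) :
    HasJet (fun t => f t * g t) (f₀ * g₀) (f₀ * g₁ + f₁ * g₀)
      (f₀ * g₂ + 2 * (f₁ * g₁) + f₂ * g₀) := by
  obtain ⟨rfl, f', hf', rfl, hf2⟩ := hf
  obtain ⟨rfl, g', hg', rfl, hg2⟩ := hg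
  refine ⟨rfl, fun t => f t * g' t + f' t * g t, ?_, rfl, ?_⟩
  · filter_upwards [hf', hg'] with t h1 h2 using (h1.mul h2).congr_deriv (by ring)
  · exact ((hf'.self_of_nhds.mul hg2).add (hf2.mul hg'.self_of_nhds)).congr_deriv (by ring)

/-- First and second derivative test at an interior maximum. -/
theorem of_isLocalMax {f : ℝ → ℝ} {f₀ f₁ f₂ : ℝ} (hf : HasJet f f₀ f₁ f₂) (h : IsLocalMax f 0) :
    f₁ = 0 ∧ f₂ ≤ 0 := by
  obtain ⟨rfl, f', hf', rfl, hf2⟩ := hf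
  have h1 : f' 0 = 0 := h.hasDerivAt_eq_zero hf'.self_of_nhds
  refine ⟨h1, ?_⟩
  by_contra! hpos
  have hd : deriv f =ᶠ[𝓝 0] f' := hf'.mono fun t ht => ht.deriv
  have hmin : IsLocalMin f 0 := by
    refine isLocalMin_of_deriv_deriv_pos ?_ ?_ hf'.self_of_nhds.continuousAt
    · rwa [hd.deriv_eq, hf2.deriv]
    · rw [hd.self_of_nhds, h1]
  -- A positive second derivative would make 0 a local minimum as well, hence f locally constant,
  -- and the second derivative would vanish after all.
  have hconst : f =ᶠ[𝓝 0] fun _ => f 0 := by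
    filter_upwards [h, hmin] with t h1 h2 using le_antisymm h1 h2
  have hz : f' =ᶠ[𝓝 0] fun _ => 0 := by
    filter_upwards [hf', hconst.eventuallyEq_nhds] with t h1 h2
    have := h1.congr_of_eventuallyEq h2.symm
    exact this.unique (hasDerivAt_const _ _)
  have := (hf2.congr_of_eventuallyEq hz.symm).unique (hasDerivAt_const _ _)
  linarith

end HasJet

end Jets

/-! ### Local calculus of graphs and the two estimates at penalized maxima. -/

section Graph

open Filter Topology

variable {V : Type*} [NormedAddCommGroup V] [InnerProductSpace ℝ V]

theorem one_add_inner_self_pos (v : V) : 0 < 1 + ⟪v, v⟫_ℝ :=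
  add_pos_of_pos_of_nonneg one_pos real_inner_self_nonneg

theorem hasDerivAt_line (e : V) (t : ℝ) : HasDerivAt (fun t : ℝ => t • e) e t := by
  simpa using (hasDerivAt_id t).smul_const e

theorem hasDerivAt_comp_line {G : Type*} [NormedAddCommGroup G] [NormedSpace ℝ G] {h : V → G}
    {e : V} {t : ℝ} (hh : DifferentiableAt ℝ h (t • e)) :
    HasDerivAt (fun t : ℝ => h (t • e)) (fderiv ℝ h (t • e) e) t :=
  hh.hasFDerivAt.comp_hasDerivAt t (hasDerivAt_line e t)

theorem hasDerivAt_comp_line_zero {G : Type*} [NormedAddCommGroup G] [NormedSpace ℝ G] {h : V → G}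
    {e : V} (hh : DifferentiableAt ℝ h 0) :
    HasDerivAt (fun t : ℝ => h (t • e)) (fderiv ℝ h 0 e) 0 := by
  simpa using hasDerivAt_comp_line (t := 0) (e := e) (h := h) (by simpa using hh)

theorem tendsto_line (e : V) : Tendsto (fun t : ℝ => t • e) (𝓝 0) (𝓝 0) := by
  simpa using (hasDerivAt_line e 0).continuousAt.tendsto

/-- Expand |a + a'/2|² ≥ 0. The bound does not involve a, which will be the unbounded tangential
part of the position. -/
theorem inner_ge_neg_quarter (a a' : V) : -(⟪a', a'⟫_ℝ / 4) ≤ ⟪a, a⟫_ℝ + ⟪a', a⟫_ℝ := by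
  have h := real_inner_self_nonneg (x := a + (1 / 2 : ℝ) • a')
  rw [inner_add_left, inner_add_right, inner_add_right, inner_smul_left, inner_smul_left,
    inner_smul_right, inner_smul_right, real_inner_comm a a'] at h
  rw [real_inner_comm a a']
  simp only [conj_trivial] at h
  linarith

variable [FiniteDimensional ℝ V]

/-- The gradient of `f`. -/
def grad (f : V → ℝ) (w : V) : V :=
  ∑ i, fderiv ℝ f w (stdOrthonormalBasis ℝ V i) • stdOrthonormalBasis ℝ V i

theorem inner_grad (f : V → ℝ) (w v : V) : ⟪grad f w, v⟫_ℝ = fderiv ℝ f w v := by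
  conv_rhs => rw [← (stdOrthonormalBasis ℝ V).sum_repr' v]
  simp [grad, sum_inner, inner_smul_left, mul_comm]

/-- The factor `√(1 + |∇f|²)` of the graph of `f`. -/
def areaFactor (f : V → ℝ) (w : V) : ℝ := √(1 + ⟪grad f w, grad f w⟫_ℝ)

/-- The tangential part `∇f / √(1 + |∇f|²)` of minus the unit normal of the graph of `f`. -/
def slope (f : V → ℝ) (w : V) : V := (areaFactor f w)⁻¹ • grad f w

theorem areaFactor_pos (f : V → ℝ) (w : V) : 0 < areaFactor f w :=
  Real.sqrt_pos.2 (one_add_inner_self_pos _)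

theorem areaFactor_sq (f : V → ℝ) (w : V) : areaFactor f w ^ 2 = 1 + ⟪grad f w, grad f w⟫_ℝ :=
  Real.sq_sqrt (one_add_inner_self_pos _).le

variable {f : V → ℝ} {w : V}

theorem contDiffAt_grad (hf : ContDiffAt ℝ 3 f w) : ContDiffAt ℝ 2 (grad f) w := by
  unfold grad
  refine ContDiffAt.sum fun i _ => ContDiffAt.smul ?_ contDiffAt_const
  exact (hf.fderiv_right (m := 2) (by norm_num)).clm_apply contDiffAt_const

theorem contDiffAt_areaFactor_inv (hf : ContDiffAt ℝ 3 f w) :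
    ContDiffAt ℝ 2 (fun w => (areaFactor f w)⁻¹) w := by
  have h := contDiffAt_grad hf
  refine ContDiffAt.inv ?_ (areaFactor_pos f w).ne'
  exact (contDiffAt_const.add (h.inner ℝ h)).sqrt (one_add_inner_self_pos _).ne'

theorem contDiffAt_slope (hf : ContDiffAt ℝ 3 f w) : ContDiffAt ℝ 2 (slope f) w :=
  (contDiffAt_areaFactor_inv hf).smul (contDiffAt_grad hf)

theorem differentiableAt_fderiv_grad (hf : ContDiffAt ℝ 3 f w) :
    DifferentiableAt ℝ (fderiv ℝ (grad f)) w :=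
  ((contDiffAt_grad hf).fderiv_right (m := 1) (by norm_num)).differentiableAt (by simp)

theorem inner_fderiv_grad (hf : ContDiffAt ℝ 3 f w) (x y : V) :
    ⟪fderiv ℝ (grad f) w x, y⟫_ℝ = fderiv ℝ (fderiv ℝ f) w x y := by
  have hG : DifferentiableAt ℝ (grad f) w := (contDiffAt_grad hf).differentiableAt (by simp)
  have hF : DifferentiableAt ℝ (fderiv ℝ f) w :=
    (hf.fderiv_right (m := 2) (by norm_num)).differentiableAt (by simp)
  have h1 : HasFDerivAt (fun w => ⟪grad f w, y⟫_ℝ)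
      ((innerSL ℝ y).comp (fderiv ℝ (grad f) w)) w := by
    have := (innerSL ℝ y).hasFDerivAt.comp w hG.hasFDerivAt
    refine this.congr_of_eventuallyEq (.of_forall fun z => ?_)
    simp [real_inner_comm]
  have h2 : HasFDerivAt (fun w => ⟪grad f w, y⟫_ℝ)
      ((ContinuousLinearMap.apply ℝ ℝ y).comp (fderiv ℝ (fderiv ℝ f) w)) w := by
    have := (ContinuousLinearMap.apply ℝ ℝ y).hasFDerivAt.comp w hF.hasFDerivAt
    refine this.congr_of_eventuallyEq (.of_forall fun z => ?_)
    simp [inner_grad]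
  have := congrArg (fun L => L x) (h1.unique h2)
  simpa [real_inner_comm] using this

theorem inner_fderiv_grad_comm (hf : ContDiffAt ℝ 3 f w) (x y : V) :
    ⟪fderiv ℝ (grad f) w x, y⟫_ℝ = ⟪fderiv ℝ (grad f) w y, x⟫_ℝ := by
  rw [inner_fderiv_grad hf, inner_fderiv_grad hf]
  exact (hf.isSymmSndFDerivAt (by simp; norm_num)) x y

theorem fderiv_fderiv_grad_comm (hf : ContDiffAt ℝ 3 f w) (x y : V) :
    fderiv ℝ (fderiv ℝ (grad f)) w x y = fderiv ℝ (fderiv ℝ (grad f)) w y x :=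
  ((contDiffAt_grad hf).isSymmSndFDerivAt (by simp)) x y

/-- Differentiate the symmetry of the Hessian along a line. With `fderiv_fderiv_grad_comm` this
makes the third derivative totally symmetric, which is the Codazzi equation in graph coordinates. -/
theorem inner_fderiv_fderiv_grad_comm (hf : ContDiffAt ℝ 3 f 0) (a x y : V) :
    ⟪fderiv ℝ (fderiv ℝ (grad f)) 0 a x, y⟫_ℝ = ⟪fderiv ℝ (fderiv ℝ (grad f)) 0 a y, x⟫_ℝ := by
  have h := hasDerivAt_comp_line_zero (e := a) (differentiableAt_fderiv_grad hf)
  have h1 := (h.clm_apply (hasDerivAt_const (0 : ℝ) x)).inner ℝ (hasDerivAt_const (0 : ℝ) y)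
  have h2 := (h.clm_apply (hasDerivAt_const (0 : ℝ) y)).inner ℝ (hasDerivAt_const (0 : ℝ) x)
  have he : (fun t : ℝ => ⟪fderiv ℝ (grad f) (t • a) x, y⟫_ℝ) =ᶠ[𝓝 0]
      fun t : ℝ => ⟪fderiv ℝ (grad f) (t • a) y, x⟫_ℝ := by
    filter_upwards [(tendsto_line a).eventually (hf.eventually (by simp))] with t ht
    exact inner_fderiv_grad_comm ht x y
  simpa using h1.unique (h2.congr_of_eventuallyEq he)

theorem hasJet_grad_line (hf : ContDiffAt ℝ 3 f 0) (e : V) :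
    HasJet (fun t : ℝ => grad f (t • e)) (grad f 0) (fderiv ℝ (grad f) 0 e)
      (fderiv ℝ (fderiv ℝ (grad f)) 0 e e) := by
  refine ⟨by simp, fun t => fderiv ℝ (grad f) (t • e) e, ?_, by simp, ?_⟩
  · filter_upwards [(tendsto_line e).eventually (hf.eventually (by simp))] with t ht
    exact hasDerivAt_comp_line ((contDiffAt_grad ht).differentiableAt (by simp))
  · simpa using (hasDerivAt_comp_line_zero (e := e) (differentiableAt_fderiv_grad hf)).clm_apply
      (hasDerivAt_const (0 : ℝ) e)

theorem hasJet_line (hf : ContDiffAt ℝ 3 f 0) (e : V) :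
    HasJet (fun t : ℝ => f (t • e)) (f 0) ⟪grad f 0, e⟫_ℝ ⟪fderiv ℝ (grad f) 0 e, e⟫_ℝ := by
  refine ⟨by simp, fun t => ⟪grad f (t • e), e⟫_ℝ, ?_, by simp, ?_⟩
  · filter_upwards [(tendsto_line e).eventually (hf.eventually (by simp))] with t ht
    rw [inner_grad]
    exact hasDerivAt_comp_line (ht.differentiableAt (by simp))
  · simpa using (hasDerivAt_comp_line_zero (e := e)
      ((contDiffAt_grad hf).differentiableAt (by simp))).inner ℝ (hasDerivAt_const (0 : ℝ) e)

/-- `q = -⟪X, N⟫ √(1 + |∇f|²)` for the graph of `f`, where the base point of the graph has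
tangential part `a` and normal part `c`. -/
def supportFun (f : V → ℝ) (a : V) (c : ℝ) (w : V) : ℝ := -c - f w + ⟪grad f w, a + w⟫_ℝ

/-- The squared distance of the points of the graph of `f` to a point whose difference with the
base point of the graph has tangential part `a` and normal part `c`. -/
def sqDist (f : V → ℝ) (a : V) (c : ℝ) (w : V) : ℝ := ⟪a + w, a + w⟫_ℝ + (c + f w) * (c + f w)

theorem hasJet_supportFun (hf : ContDiffAt ℝ 3 f 0) (h0 : f 0 = 0) (hg : grad f 0 = 0)
    (a : V) (c : ℝ) (e : V) :
    HasJet (fun t : ℝ => supportFun f a c (t • e)) (-c) ⟪fderiv ℝ (grad f) 0 e, a⟫_ℝ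
      (⟪fderiv ℝ (fderiv ℝ (grad f)) 0 e e, a⟫_ℝ + ⟪fderiv ℝ (grad f) 0 e, e⟫_ℝ) := by
  have h := ((HasJet.const (-c)).sub (hasJet_line hf e)).add
    ((hasJet_grad_line hf e).inner (HasJet.affine a e))
  simp only [h0, hg, inner_zero_left, inner_zero_right, sub_zero, zero_add, add_zero, zero_sub] at h
  exact h.congr rfl rfl (by ring)

theorem hasJet_sqDist (hf : ContDiffAt ℝ 3 f 0) (h0 : f 0 = 0) (hg : grad f 0 = 0)
    (a : V) (c : ℝ) (e : V) :
    HasJet (fun t : ℝ => sqDist f a c (t • e)) (⟪a, a⟫_ℝ + c * c) (2 * ⟪a, e⟫_ℝ)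
      (2 * ⟪e, e⟫_ℝ + 2 * c * ⟪fderiv ℝ (grad f) 0 e, e⟫_ℝ) := by
  have h1 := (HasJet.const c).add (hasJet_line hf e)
  have h := ((HasJet.affine a e).inner (HasJet.affine a e)).add (h1.mul h1)
  simp only [h0, hg, inner_zero_left, inner_zero_right, zero_add, add_zero, mul_zero,
    zero_mul, real_inner_comm a e] at h
  exact h.congr rfl (by ring) (by ring)

/-- First and second order conditions at a maximum of the penalized square of the support
function. -/
theorem supportFun_sq_maximum (hf : ContDiffAt ℝ 3 f 0) (h0 : f 0 = 0) (hg : grad f 0 = 0)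
    {a a' : V} {c c' η : ℝ}
    (hmax : IsLocalMax (fun w => (supportFun f a c w / areaFactor f w) ^ 2 - η * sqDist f a c w
      - η * sqDist f a' c' w) 0) (e : V) :
    -(2 * c * ⟪fderiv ℝ (grad f) 0 e, a⟫_ℝ) = 2 * η * (⟪a, e⟫_ℝ + ⟪a', e⟫_ℝ) ∧
    2 * ⟪fderiv ℝ (grad f) 0 e, a⟫_ℝ ^ 2
      - 2 * c * (⟪fderiv ℝ (fderiv ℝ (grad f)) 0 e e, a⟫_ℝ + ⟪fderiv ℝ (grad f) 0 e, e⟫_ℝ)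
      - 2 * c ^ 2 * ⟪fderiv ℝ (grad f) 0 e, fderiv ℝ (grad f) 0 e⟫_ℝ
      ≤ η * (4 * ⟪e, e⟫_ℝ + 2 * (c + c') * ⟪fderiv ℝ (grad f) 0 e, e⟫_ℝ) := by
  have hq := hasJet_supportFun hf h0 hg a c e
  have hD := (HasJet.const (1 : ℝ)).add ((hasJet_grad_line hf e).inner (hasJet_grad_line hf e))
  have hS := (hasJet_sqDist hf h0 hg a c e).add (hasJet_sqDist hf h0 hg a' c' e)
  -- `m` is the maximal value. Clearing the denominator turns maximality into q² ≤ (1 + |∇f|²)(ηS +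
  -- m), with equality at 0, so no quotient has to be differentiated twice.
  set m : ℝ := c * c - η * (⟪a, a⟫_ℝ + c * c + (⟪a', a'⟫_ℝ + c' * c'))
  have hk := (hq.mul hq).sub (hD.mul (((HasJet.const η).mul hS).add (HasJet.const m)))
  obtain ⟨h1, h2⟩ := hk.of_isLocalMax (by
    filter_upwards [(tendsto_line e).eventually hmax] with t ht
    refine le_trans ?_ hk.1.ge
    have hsq := areaFactor_sq f (t • e)
    have hW := areaFactor_pos f (t • e)
    rw [← hsq]
    have e1 : supportFun f a c 0 = -c := by simpa using hq.1
    have e2 : sqDist f a c 0 = ⟪a, a⟫_ℝ + c * c := by simp [sqDist, h0]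
    have e3 : sqDist f a' c' 0 = ⟪a', a'⟫_ℝ + c' * c' := by simp [sqDist, h0]
    have e4 : areaFactor f 0 = 1 := by simp [areaFactor, hg]
    rw [e1, e2, e3, e4, div_pow, sub_sub, div_sub' (by positivity), div_le_iff₀ (by positivity)]
      at ht
    simp only [hg, inner_zero_left, m]
    nlinarith)
  simp only [hg, inner_zero_left, inner_zero_right, m] at h1 h2
  constructor
  · linarith
  · linarith

theorem areaFactor_zero (hg : grad f 0 = 0) : areaFactor f 0 = 1 := by simp [areaFactor, hg]

/-- The function is maximal where the gradient vanishes, so normalizing the normal has no first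
order effect at the base point. -/
theorem fderiv_areaFactor_inv_zero (hg : grad f 0 = 0) :
    fderiv ℝ (fun w => (areaFactor f w)⁻¹) 0 = 0 := by
  refine IsLocalMax.fderiv_eq_zero (.of_forall fun w => ?_)
  simp only [areaFactor_zero hg, inv_one]
  refine inv_le_one_of_one_le₀ (Real.one_le_sqrt.2 ?_)
  linarith [real_inner_self_nonneg (x := grad f w)]

theorem fderiv_slope (hf : ContDiffAt ℝ 3 f w) (v : V) :
    fderiv ℝ (slope f) w v = (areaFactor f w)⁻¹ • fderiv ℝ (grad f) w v +
      (fderiv ℝ (fun w => (areaFactor f w)⁻¹) w v) • grad f w := by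
  have h := (((contDiffAt_areaFactor_inv hf).differentiableAt (by simp)).hasFDerivAt.smul
    ((contDiffAt_grad hf).differentiableAt (by simp)).hasFDerivAt).fderiv
  exact congrArg (fun L => L v) h

theorem fderiv_slope_zero (hf : ContDiffAt ℝ 3 f 0) (hg : grad f 0 = 0) (v : V) :
    fderiv ℝ (slope f) 0 v = fderiv ℝ (grad f) 0 v := by
  rw [fderiv_slope hf]
  simp [areaFactor_zero hg, hg]

/-- The first variation at the origin of the derivative of the slope of a graph is the third
derivative of the graph function. -/
theorem hasDerivAt_inner_fderiv_slope (hf : ContDiffAt ℝ 3 f 0) (hg : grad f 0 = 0) (a x y : V) :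
    HasDerivAt (fun t : ℝ => ⟪x, fderiv ℝ (slope f) (t • a) y⟫_ℝ)
      ⟪x, fderiv ℝ (fderiv ℝ (grad f)) 0 a y⟫_ℝ 0 := by
  have hR := contDiffAt_areaFactor_inv hf
  have h1 := hasDerivAt_comp_line_zero (e := a) (hR.differentiableAt (by simp))
  have h2 := (hasDerivAt_comp_line_zero (e := a)
    (((hR.fderiv_right (m := 1) (by norm_num))).differentiableAt (by simp))).clm_apply
      (hasDerivAt_const (0 : ℝ) y)
  have h3 := hasDerivAt_comp_line_zero (e := a) ((contDiffAt_grad hf).differentiableAt (by simp))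
  have h4 := (hasDerivAt_comp_line_zero (e := a) (differentiableAt_fderiv_grad hf)).clm_apply
    (hasDerivAt_const (0 : ℝ) y)
  have h := (hasDerivAt_const (0 : ℝ) x).inner ℝ ((h1.smul h4).add (h2.smul h3))
  refine (h.congr_of_eventuallyEq ?_).congr_deriv ?_
  · filter_upwards [(tendsto_line a).eventually (hf.eventually (by simp))] with t ht
    rw [fderiv_slope ht]
    rfl
  · simp [fderiv_areaFactor_inv_zero hg, areaFactor_zero hg, hg]

variable {ι : Type*} [Fintype ι]

/-- The bound for the support function of a self-shrinking graph at a maximum of its penalized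
square. -/
theorem support_sq_le_of_isLocalMax (hf : ContDiffAt ℝ 3 f 0) (h0 : f 0 = 0) (hg : grad f 0 = 0)
    {a a' : V} {c c' η : ℝ} (hη : 0 < η)
    (hmax : IsLocalMax (fun w => (supportFun f a c w / areaFactor f w) ^ 2 - η * sqDist f a c w
      - η * sqDist f a' c' w) 0)
    (b : OrthonormalBasis ι ℝ V) {l : ι → ℝ} (hl : ∀ i, fderiv ℝ (grad f) 0 (b i) = l i • b i)
    {k : ℕ} (hk : k + 1 ≤ Module.finrank ℝ V)
    (hp : ∀ i, 0 ≤ newtonValue (Finset.univ.val.map l) k (l i))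
    (hs : ∀ᶠ w in 𝓝 0, (fderiv ℝ (slope f) w : V →ₗ[ℝ] V).charpoly.Splits)
    (hσ : ∀ᶠ w in 𝓝 0, sigma (fderiv ℝ (slope f) w : V →ₗ[ℝ] V) (k + 1) =
      supportFun f a c w / areaFactor f w)
    (hσ0 : (Finset.univ.val.map l).esymm (k + 1) = -c)
    {ε P : ℝ} (hε : ∑ i, newtonValue (Finset.univ.val.map l) k (l i) * l i ^ 2 ≤ k + 1 - ε)
    (hP : ∑ i, newtonValue (Finset.univ.val.map l) k (l i) ≤ P)
    (ha' : ⟪a', a'⟫_ℝ + c' * c' ≤ 1) :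
    2 * ε * c ^ 2 ≤ η * (1 + 4 * P + (k + 1)) := by
  set p : ι → ℝ := fun i => newtonValue (Finset.univ.val.map l) k (l i) with hpdef
  set A := fderiv ℝ (grad f) 0
  set K := fderiv ℝ (fderiv ℝ (grad f)) 0
  -- Differentiate the self-shrinker equation in the direction `a` of the tangential part of the
  -- position: the left side is the variation of σ_{k+1}, the right side that of the support
  -- function.
  have hvar : ∑ i, p i * ⟪b i, K a (b i)⟫_ℝ = ⟪A a, a⟫_ℝ := by
    have h1 := hasDerivAt_sigma (t₀ := 0) b
      (B := fun t : ℝ => (fderiv ℝ (slope f) (t • a) : V →ₗ[ℝ] V)) (l := l)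
      (T := (K a : V →ₗ[ℝ] V)) (fun i => by simp [fderiv_slope_zero hf hg, A, hl])
      (fun i j => hasDerivAt_inner_fderiv_slope hf hg a (b i) (b j))
      ((tendsto_line a).eventually hs) hk
    have hq : HasDerivAt (fun t : ℝ => supportFun f a c (t • a)) ⟪A a, a⟫_ℝ 0 := by
      obtain ⟨-, q', hq', hq0, -⟩ := hasJet_supportFun hf h0 hg a c a
      exact hq'.self_of_nhds.congr_deriv hq0
    have hR := hasDerivAt_comp_line_zero (e := a)
      ((contDiffAt_areaFactor_inv hf).differentiableAt (by simp))
    have h2 := hq.mul hR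
    refine h1.unique ((h2.congr_of_eventuallyEq ?_).congr_deriv ?_)
    · filter_upwards [(tendsto_line a).eventually hσ] with t ht
      rw [ht, div_eq_mul_inv]
      rfl
    · simp [fderiv_areaFactor_inv_zero hg, areaFactor_zero hg]
  have hpl : ∑ i, p i * l i = (k + 1) * -c := by
    rw [← hσ0]
    exact sum_newtonValue_mul l k
  have hfirst := (supportFun_sq_maximum hf h0 hg hmax a).1
  have hbb : ∀ i, ⟪b i, b i⟫_ℝ = 1 := fun i => by simp
  -- The square of the first derivative of the support function has the favourable sign and is
  -- dropped; multiplying by `p i` uses the semidefiniteness of the Newton transformation.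
  have hsecond : ∀ i, p i * (-(2 * c * ⟪b i, K a (b i)⟫_ℝ)) - 2 * c * (p i * l i)
      - 2 * c ^ 2 * (p i * l i ^ 2) ≤ 4 * η * p i + 2 * η * (c + c') * (p i * l i) := by
    intro i
    have h := (supportFun_sq_maximum hf h0 hg hmax (b i)).2
    have hK : ⟪K (b i) (b i), a⟫_ℝ = ⟪b i, K a (b i)⟫_ℝ := by
      rw [inner_fderiv_fderiv_grad_comm hf, fderiv_fderiv_grad_comm hf, real_inner_comm]
    change 2 * ⟪A (b i), a⟫_ℝ ^ 2 - 2 * c * (⟪K (b i) (b i), a⟫_ℝ + ⟪A (b i), b i⟫_ℝ)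
      - 2 * c ^ 2 * ⟪A (b i), A (b i)⟫_ℝ
      ≤ η * (4 * ⟪b i, b i⟫_ℝ + 2 * (c + c') * ⟪A (b i), b i⟫_ℝ) at h
    rw [hK, hl i, inner_smul_left, inner_smul_left, inner_smul_left, inner_smul_right, hbb] at h
    simp only [conj_trivial, mul_one] at h
    have h' : -(2 * c * (⟪b i, K a (b i)⟫_ℝ + l i)) - 2 * c ^ 2 * (l i * l i)
        ≤ η * (4 + 2 * (c + c') * l i) := by
      nlinarith [sq_nonneg (l i * ⟪b i, a⟫_ℝ)]
    have := mul_le_mul_of_nonneg_left h' (hp i)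
    linarith
  have hsum := Finset.sum_le_sum fun i (_ : i ∈ Finset.univ) => hsecond i
  simp only [Finset.sum_sub_distrib, Finset.sum_add_distrib, ← Finset.mul_sum, mul_neg,
    Finset.sum_neg_distrib, hpl] at hsum
  have e1 : ∑ i, p i * (2 * c * ⟪b i, K a (b i)⟫_ℝ) = 2 * c * ⟪A a, a⟫_ℝ := by
    rw [← hvar, Finset.mul_sum]
    exact Finset.sum_congr rfl fun i _ => by ring
  rw [e1] at hsum
  -- The summed third order term is the gradient term -2c⟨Aa, a⟩, which the first order condition
  -- equates with 2η(|a|² + ⟨a', a⟩).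
  have hquart := inner_ge_neg_quarter a a'
  have h3 : c ^ 2 * ∑ i, p i * l i ^ 2 ≤ c ^ 2 * (k + 1 - ε) :=
    mul_le_mul_of_nonneg_left hε (sq_nonneg c)
  have h4 : η * (-(⟪a', a'⟫_ℝ / 4)) ≤ η * (⟪a, a⟫_ℝ + ⟪a', a⟫_ℝ) :=
    mul_le_mul_of_nonneg_left hquart hη.le
  have h5 : η * ∑ i, p i ≤ η * P := mul_le_mul_of_nonneg_left hP hη.le
  have h6 : 0 ≤ ⟪a', a'⟫_ℝ := real_inner_self_nonneg
  -- This absorbs the penalty's normal part: -2c(c + c') = -2(c + c'/2)² + c'²/2.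
  have h7 : 0 ≤ η * (k + 1) * (c + c' / 2) ^ 2 := by positivity
  have h8 : η * (⟪a', a'⟫_ℝ + c' * c') ≤ η * 1 := mul_le_mul_of_nonneg_left ha' hη.le
  have h9 : 0 ≤ η * (c' * c') := mul_nonneg hη.le (mul_self_nonneg _)
  have h10 : η * (k + 1) * (c' * c') ≤ η * (k + 1) * 1 :=
    mul_le_mul_of_nonneg_left (by linarith) (by positivity)
  have h11 : 0 ≤ η * ((k : ℝ) + 1) := by positivity
  change -(2 * c * ⟪A a, a⟫_ℝ) = 2 * η * (⟪a, a⟫_ℝ + ⟪a', a⟫_ℝ) at hfirst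
  nlinarith

/-- The bound for the second fundamental form of a minimal cone graph at a maximum of its penalized
squared norm. -/
theorem trace_sq_le_of_isLocalMax (hf : ContDiffAt ℝ 3 f 0) (h0 : f 0 = 0) (hg : grad f 0 = 0)
    {a a' : V} {c c' η : ℝ} (hη : 0 < η)
    (hq : ∀ᶠ w in 𝓝 0, supportFun f a c w = 0)
    (hmax : IsLocalMax (fun w => LinearMap.trace ℝ V ((fderiv ℝ (slope f) w : V →ₗ[ℝ] V) ∘ₗ
      (fderiv ℝ (slope f) w : V →ₗ[ℝ] V)) - η * sqDist f a c w - η * sqDist f a' c' w) 0)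
    (ha' : ⟪a', a'⟫_ℝ ≤ 1) :
    LinearMap.trace ℝ V ((fderiv ℝ (slope f) 0 : V →ₗ[ℝ] V) ∘ₗ
      (fderiv ℝ (slope f) 0 : V →ₗ[ℝ] V)) ≤ η := by
  set b := stdOrthonormalBasis ℝ V
  set K := fderiv ℝ (fderiv ℝ (grad f)) 0
  have hc : c = 0 := by
    have := hq.self_of_nhds
    simpa [supportFun, h0, hg] using this
  -- Differentiating the vanishing of the support function puts the tangential position `a + w` in
  -- the kernel of the Hessian. Differentiating this again at 0 gives the claim: the Hessian is
  -- homogeneous of degree -1.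
  have hK : ∀ v, K a v = -fderiv ℝ (grad f) 0 v := by
    intro v
    have hker : ∀ᶠ w in 𝓝 0, fderiv ℝ (grad f) w (a + w) = 0 := by
      filter_upwards [hq.eventually_nhds, hf.eventually (by simp)] with w hw hfw
      refine ext_inner_right ℝ fun x => ?_
      have hG := ((contDiffAt_grad hfw).differentiableAt (by simp)).hasFDerivAt
      have h1 : HasDerivAt (fun t : ℝ => supportFun f a c (w + t • x))
          (-⟪grad f w, x⟫_ℝ + (⟪grad f w, x⟫_ℝ + ⟪fderiv ℝ (grad f) w x, a + w⟫_ℝ)) 0 := by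
        have hline : HasDerivAt (fun t : ℝ => w + t • x) x 0 := (hasDerivAt_line x 0).const_add w
        have hF := (hfw.differentiableAt (by simp)).hasFDerivAt
        have e1 : HasDerivAt (fun t : ℝ => f (w + t • x)) (fderiv ℝ f w x) 0 :=
          HasFDerivAt.comp_hasDerivAt (𝕜 := ℝ) (l := f) 0 (by simpa using hF) hline
        have e2 : HasDerivAt (fun t : ℝ => grad f (w + t • x)) (fderiv ℝ (grad f) w x) 0 :=
          HasFDerivAt.comp_hasDerivAt (𝕜 := ℝ) (l := grad f) 0 (by simpa using hG) hline
        refine ((e1.const_sub (-c)).add (e2.inner ℝ (hline.const_add a))).congr_deriv ?_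
        simp [inner_grad]
      have h2 : (fun t : ℝ => supportFun f a c (w + t • x)) =ᶠ[𝓝 0] fun _ => 0 := by
        have ht : Tendsto (fun t : ℝ => w + t • x) (𝓝 0) (𝓝 w) := by
          simpa using ((hasDerivAt_line x 0).const_add w).continuousAt.tendsto
        exact ht.eventually hw
      have h3 := h1.unique ((hasDerivAt_const (0 : ℝ) (0 : ℝ)).congr_of_eventuallyEq h2)
      rw [inner_fderiv_grad_comm hfw, inner_zero_left]
      linarith
    have h1 := (hasDerivAt_comp_line_zero (e := v) (differentiableAt_fderiv_grad hf)).clm_apply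
      ((hasDerivAt_line v 0).const_add a)
    have h2 : (fun t : ℝ => fderiv ℝ (grad f) (t • v) (a + t • v)) =ᶠ[𝓝 0] fun _ => 0 :=
      (tendsto_line v).eventually hker
    have h3 := h1.unique ((hasDerivAt_const (0 : ℝ) (0 : V)).congr_of_eventuallyEq h2)
    simp only [zero_smul, add_zero] at h3
    rw [fderiv_fderiv_grad_comm hf]
    exact eq_neg_of_add_eq_zero_left h3
  have htr : ∀ B : V →ₗ[ℝ] V, LinearMap.trace ℝ V (B ∘ₗ B) =
      ∑ i, ∑ j, ⟪b i, B (b j)⟫_ℝ * ⟪b j, B (b i)⟫_ℝ := by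
    intro B
    rw [LinearMap.trace_eq_sum_inner _ b]
    refine Finset.sum_congr rfl fun i _ => ?_
    rw [LinearMap.comp_apply]
    conv_lhs => rw [← b.sum_repr' (B (b i))]
    simp [inner_sum, inner_smul_right, mul_comm]
  have hd : HasDerivAt (fun t : ℝ => LinearMap.trace ℝ V
      ((fderiv ℝ (slope f) (t • a) : V →ₗ[ℝ] V) ∘ₗ (fderiv ℝ (slope f) (t • a) : V →ₗ[ℝ] V)))
      (-(2 * LinearMap.trace ℝ V ((fderiv ℝ (slope f) 0 : V →ₗ[ℝ] V) ∘ₗ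
        (fderiv ℝ (slope f) 0 : V →ₗ[ℝ] V)))) 0 := by
    simp only [htr]
    refine (HasDerivAt.fun_sum fun i _ => HasDerivAt.fun_sum fun j _ =>
      (hasDerivAt_inner_fderiv_slope hf hg a (b i) (b j)).mul
        (hasDerivAt_inner_fderiv_slope hf hg a (b j) (b i))).congr_deriv ?_
    rw [Finset.mul_sum, ← Finset.sum_neg_distrib]
    refine Finset.sum_congr rfl fun i _ => ?_
    rw [Finset.mul_sum, ← Finset.sum_neg_distrib]
    refine Finset.sum_congr rfl fun j _ => ?_
    change ⟪b i, K a (b j)⟫_ℝ * _ + _ * ⟪b j, K a (b i)⟫_ℝ = _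
    rw [hK, hK]
    simp only [zero_smul, ContinuousLinearMap.coe_coe, fderiv_slope_zero hf hg, inner_neg_right]
    ring
  have hS : ∀ (x : V) (y : ℝ), HasDerivAt (fun t : ℝ => sqDist f x y (t • a)) (2 * ⟪x, a⟫_ℝ) 0 := by
    intro x y
    obtain ⟨-, q', hq', hq0, -⟩ := hasJet_sqDist hf h0 hg x y a
    exact hq'.self_of_nhds.congr_deriv hq0
  have hm : IsLocalMax (fun t : ℝ => LinearMap.trace ℝ V
      ((fderiv ℝ (slope f) (t • a) : V →ₗ[ℝ] V) ∘ₗ (fderiv ℝ (slope f) (t • a) : V →ₗ[ℝ] V))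
      - η * sqDist f a c (t • a) - η * sqDist f a' c' (t • a)) 0 := by
    filter_upwards [(tendsto_line a).eventually hmax] with t ht
    simpa using ht
  -- By homogeneity of degree -2 the derivative along `a` already reproduces the squared norm, so
  -- the first order condition suffices.
  have hz := hm.hasDerivAt_eq_zero ((hd.sub ((hS a c).const_mul η)).sub ((hS a' c').const_mul η))
  have hquart := inner_ge_neg_quarter a a'
  nlinarith

end Graph

/-! ### Lifting segments through local homeomorphisms. -/

section Lifting

open Filter Topology Set Metric

variable {Y : Type*} [MetricSpace Y] {V : Type*} [NormedAddCommGroup V] [NormedSpace ℝ V]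
  {F : Y → V}

/-- Segments lift through a local homeomorphism whose lifts of segments are Lipschitz. -/
theorem exists_segment_lift (hF : IsLocalHomeomorph F) (p : Y) (w : V) {C : ℝ}
    (hcomp : IsComplete (closedBall p C))
    (hlip : ∀ (γ : ℝ → Y) (a b : ℝ), 0 ≤ a → a ≤ b → b ≤ 1 → ContinuousOn γ (Icc a b) →
      (∀ t ∈ Icc a b, F (γ t) = F p + t • w) → dist (γ a) (γ b) ≤ C * (b - a)) :
    ∃ γ : ℝ → Y, ContinuousOn γ (Icc 0 1) ∧ γ 0 = p ∧ ∀ t ∈ Icc (0 : ℝ) 1,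
      F (γ t) = F p + t • w := by
  set T : Set ℝ := {t | ∃ γ : ℝ → Y, ContinuousOn γ (Icc 0 t) ∧ γ 0 = p ∧ ∀ s ∈ Icc 0 t,
    F (γ s) = F p + s • w} with hT
  suffices h : Icc (0 : ℝ) 1 ⊆ T from h (right_mem_Icc.2 zero_le_one)
  have huniq : ∀ {t : ℝ} {γ γ' : ℝ → Y}, ContinuousOn γ (Icc 0 t) → ContinuousOn γ' (Icc 0 t) →
      γ 0 = p → γ' 0 = p → (∀ s ∈ Icc 0 t, F (γ s) = F p + s • w) →
      (∀ s ∈ Icc 0 t, F (γ' s) = F p + s • w) → EqOn γ γ' (Icc 0 t) := by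
    intro t γ γ' h1 h2 h3 h4 h5 h6 s hs
    exact (T2Space.isSeparatedMap F).eqOn_of_comp_eqOn hF.isLocallyInjective isPreconnected_Icc
      h1 h2 (fun x hx => (h5 x hx).trans (h6 x hx).symm) (a := 0)
      ⟨le_rfl, hs.1.trans hs.2⟩ (h3.trans h4.symm) hs
  have hcont : Continuous fun t : ℝ => F p + t • w := by fun_prop
  -- Continuous induction on the times up to which a lift exists: Lipschitz control and completeness
  -- give closedness, the local inverse gives extension to the right.
  refine IsClosed.Icc_subset_of_forall_exists_gt ?_ ?_ ?_
  · rw [← isSeqClosed_iff_isClosed]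
    intro u x hu hx
    have hx01 : x ∈ Icc (0 : ℝ) 1 :=
      isClosed_Icc.mem_of_tendsto hx (.of_forall fun n => (hu n).2)
    refine ⟨?_, hx01⟩
    by_cases hex : ∃ n, x ≤ u n
    · obtain ⟨n, hn⟩ := hex
      obtain ⟨γ, h1, h2, h3⟩ := (hu n).1
      exact ⟨γ, h1.mono (Icc_subset_Icc_right hn), h2, fun s hs => h3 s ⟨hs.1, hs.2.trans hn⟩⟩
    push Not at hex
    have hx0 : 0 < x := (hu 0).2.1.trans_lt (hex 0)
    have hlift : ∀ t, 0 ≤ t → t < x → t ∈ T := by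
      intro t _ htx
      obtain ⟨n, hn⟩ := (hx.eventually (lt_mem_nhds htx)).exists
      obtain ⟨γ, h1, h2, h3⟩ := (hu n).1
      exact ⟨γ, h1.mono (Icc_subset_Icc_right hn.le), h2,
        fun s hs => h3 s ⟨hs.1, hs.2.trans hn.le⟩⟩
    have : Nonempty (ℝ → Y) := ⟨fun _ => p⟩
    choose! L hL1 hL2 hL3 using hlift
    set Γ : ℝ → Y := fun t => L t t with hΓ
    -- Uniqueness of lifts glues the lifts on shorter intervals into one on [0, x).
    have hΓL : ∀ t, 0 ≤ t → t < x → EqOn Γ (L t) (Icc 0 t) := by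
      intro t ht0 htx s hs
      have hsx := hs.2.trans_lt htx
      exact huniq (hL1 s hs.1 hsx) ((hL1 t ht0 htx).mono (Icc_subset_Icc_right hs.2))
        (hL2 s hs.1 hsx) (hL2 t ht0 htx) (hL3 s hs.1 hsx)
        (fun y hy => hL3 t ht0 htx y ⟨hy.1, hy.2.trans hs.2⟩) (right_mem_Icc.2 hs.1)
    have hΓF : ∀ t, 0 ≤ t → t < x → F (Γ t) = F p + t • w := fun t ht0 htx =>
      hL3 t ht0 htx t (right_mem_Icc.2 ht0)
    have hΓ0 : Γ 0 = p := hL2 0 le_rfl hx0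
    have hΓc : ∀ t, 0 ≤ t → t < x → ContinuousOn Γ (Icc 0 t) := fun t ht0 htx =>
      (hL1 t ht0 htx).congr (hΓL t ht0 htx)
    have hΓd : ∀ s t, 0 ≤ s → s ≤ t → t < x → dist (Γ s) (Γ t) ≤ C * (t - s) := by
      intro s t hs hst ht
      refine hlip Γ s t hs hst (ht.le.trans hx01.2)
        ((hΓc t (hs.trans hst) ht).mono (Icc_subset_Icc_left hs)) fun r hr => ?_
      exact hΓF r (hs.trans hr.1) (hr.2.trans_lt ht)
    have hC : 0 ≤ C := by
      have h := dist_nonneg.trans (hΓd 0 (x / 2) le_rfl (by linarith) (by linarith))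
      by_contra hneg
      push Not at hneg
      nlinarith
    have hball : ∀ t, 0 ≤ t → t < x → Γ t ∈ closedBall p C := by
      intro t ht0 htx
      rw [mem_closedBall, dist_comm]
      have := hΓd 0 t le_rfl ht0 htx
      rw [hΓ0] at this
      nlinarith [hx01.2]
    have hcauchy : Cauchy (map Γ (𝓝[Ico 0 x] x)) := by
      have hne : (𝓝[Ico 0 x] x).NeBot := by
        rw [← mem_closure_iff_nhdsWithin_neBot, closure_Ico hx0.ne]
        exact right_mem_Icc.2 hx0.le
      refine Metric.cauchy_iff.2 ⟨hne.map Γ, fun ε hε => ?_⟩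
      refine ⟨Γ '' (Ico 0 x ∩ Ioi (x - ε / (C + 1))), image_mem_map ?_, ?_⟩
      · exact inter_mem self_mem_nhdsWithin (mem_nhdsWithin_of_mem_nhds
          (Ioi_mem_nhds (by have : 0 < ε / (C + 1) := by positivity
                            linarith)))
      · have key : ∀ s t, s ∈ Ico 0 x ∩ Ioi (x - ε / (C + 1)) →
            t ∈ Ico 0 x ∩ Ioi (x - ε / (C + 1)) → s ≤ t → dist (Γ s) (Γ t) < ε := by
          intro s t hs ht hst
          have h1 := hΓd s t hs.1.1 hst ht.1.2
          have h2 : t - s < ε / (C + 1) := by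
            have h3 := hs.2
            have h4 := ht.1.2
            simp only [mem_Ioi] at h3
            linarith
          rw [lt_div_iff₀ (by positivity)] at h2
          nlinarith
        rintro _ ⟨s, hs, rfl⟩ _ ⟨t, ht, rfl⟩
        rcases le_total s t with h | h
        · exact key s t hs ht h
        · rw [dist_comm]
          exact key t s ht hs h
    obtain ⟨z, -, hz⟩ := hcomp _ hcauchy (by
      rw [le_principal_iff, mem_map]
      filter_upwards [self_mem_nhdsWithin] with t ht using hball t ht.1 ht.2)
    refine ⟨Function.update Γ x z, ?_, ?_, ?_⟩
    · intro t ht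
      rcases ht.2.lt_or_eq with htx | rfl
      · obtain ⟨m, hm1, hm2⟩ := exists_between htx
        have h1 : ContinuousWithinAt Γ (Icc 0 m) t :=
          hΓc m (ht.1.trans hm1.le) hm2 t ⟨ht.1, hm1.le⟩
        have h2 : ContinuousWithinAt Γ (Icc 0 x) t := by
          refine h1.mono_of_mem_nhdsWithin ?_
          have : Icc 0 m = Icc 0 x ∩ Iic m := by
            ext r
            simp only [mem_Icc, mem_inter_iff, mem_Iic]
            constructor
            · rintro ⟨h3, h4⟩
              exact ⟨⟨h3, h4.trans hm2.le⟩, h4⟩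
            · rintro ⟨⟨h3, -⟩, h4⟩
              exact ⟨h3, h4⟩
          rw [this]
          exact inter_mem self_mem_nhdsWithin (mem_nhdsWithin_of_mem_nhds (Iic_mem_nhds hm1))
        refine h2.congr_of_eventuallyEq ?_ (Function.update_of_ne htx.ne _ _)
        filter_upwards [mem_nhdsWithin_of_mem_nhds (Iio_mem_nhds htx)] with r hr
        exact Function.update_of_ne hr.ne _ _
      · rw [continuousWithinAt_update_same]
        rwa [Icc_sdiff_right]
    · rw [Function.update_of_ne hx0.ne, hΓ0]
    · intro s hs
      rcases hs.2.lt_or_eq with hsx | rfl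
      · rw [Function.update_of_ne hsx.ne]
        exact hΓF s hs.1 hsx
      · rw [Function.update_self]
        have h1 : Tendsto (fun t => F (Γ t)) (𝓝[Ico 0 s] s) (𝓝 (F z)) :=
          (hF.continuous.tendsto z).comp hz
        have h2 : Tendsto (fun t => F (Γ t)) (𝓝[Ico 0 s] s) (𝓝 (F p + s • w)) := by
          refine (hcont.continuousWithinAt (s := Ico 0 s) (x := s)).tendsto.congr' ?_
          filter_upwards [self_mem_nhdsWithin] with t ht using (hΓF t ht.1 ht.2).symm
        have hne : (𝓝[Ico 0 s] s).NeBot := by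
          rw [← mem_closure_iff_nhdsWithin_neBot, closure_Ico hx0.ne]
          exact right_mem_Icc.2 hx0.le
        exact tendsto_nhds_unique h1 h2
  · exact ⟨fun _ => p, continuousOn_const, rfl, fun s hs => by
      rw [le_antisymm hs.2 hs.1, zero_smul, add_zero]⟩
  · rintro t ⟨⟨γ, h1, h2, h3⟩, ht⟩ y hy
    obtain ⟨e, he, rfl⟩ := hF (γ t)
    have het : e p + t • w ∈ e.target := by
      rw [← h3 t (right_mem_Icc.2 ht.1)]
      exact e.map_source he
    have hnh : ∀ᶠ s in 𝓝[>] t, ∀ r ∈ Icc t s, e p + r • w ∈ e.target := by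
      have : ∀ᶠ r in 𝓝 t, e p + r • w ∈ e.target :=
        hcont.continuousAt.eventually (e.open_target.mem_nhds het)
      obtain ⟨δ, hδ, hball⟩ := Metric.eventually_nhds_iff.1 this
      filter_upwards [Ioo_mem_nhdsGT (show t < t + δ by linarith)] with s hs r hr
      refine hball ?_
      rw [Real.dist_eq, abs_of_nonneg (by linarith [hr.1])]
      linarith [hr.2, hs.2]
    obtain ⟨s, hs, hsy⟩ := (hnh.and (Ioc_mem_nhdsGT hy)).exists
    refine ⟨s, ?_, hsy⟩
    refine ⟨fun r => if r ≤ t then γ r else e.symm (e p + r • w), ?_, by simp [ht.1, h2], ?_⟩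
    · have hunion : Icc 0 s = Icc 0 t ∪ Icc t s := (Icc_union_Icc_eq_Icc ht.1 hsy.1.le).symm
      rw [hunion]
      refine ContinuousOn.union_of_isClosed ?_ ?_ isClosed_Icc isClosed_Icc
      · exact h1.congr fun r hr => if_pos hr.2
      · refine (e.continuousOn_symm.comp hcont.continuousOn hs).congr fun r hr => ?_
        rcases hr.1.lt_or_eq with h | rfl
        · exact if_neg (not_le.2 h)
        · simp only [le_refl, if_true, Function.comp_apply]
          rw [← h3 t (right_mem_Icc.2 ht.1), e.left_inv he]
    · intro r hr
      dsimp only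
      split_ifs with h
      · exact h3 r ⟨hr.1, h⟩
      · exact e.right_inv (hs r ⟨(not_le.1 h).le, hr.2⟩)

/-- Continuous sections of a local homeomorphism obtained by lifting segments. -/
theorem exists_section (hF : IsLocalHomeomorph F) (p : Y) {L : ℝ} {S : Set V}
    (hcomp : ∀ w ∈ S, IsComplete (closedBall p (L * ‖w - F p‖)))
    (hlip : ∀ (w : V) (γ : ℝ → Y) (a b : ℝ), 0 ≤ a → a ≤ b → b ≤ 1 → ContinuousOn γ (Icc a b) →
      (∀ t ∈ Icc a b, F (γ t) = F p + t • w) → dist (γ a) (γ b) ≤ L * ‖w‖ * (b - a)) :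
    ∃ s : S → Y, Continuous s ∧ ∀ w : S, F (s w) = w ∧ dist p (s w) ≤ L * ‖(w : V) - F p‖ := by
  have h : ∀ w : S, ∃ γ : ℝ → Y, ContinuousOn γ (Icc 0 1) ∧ γ 0 = p ∧ ∀ t ∈ Icc (0 : ℝ) 1,
      F (γ t) = F p + t • ((w : V) - F p) := fun w =>
    exists_segment_lift hF p _ (hcomp w w.2) (hlip _)
  choose γ h1 h2 h3 using h
  let f : C(unitInterval × S, V) := ⟨fun x => F p + (x.1 : ℝ) • ((x.2 : V) - F p), by fun_prop⟩
  have hg := hF.continuous_lift (T2Space.isSeparatedMap F) f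
    (g := fun x : unitInterval × S => γ x.2 x.1) (funext fun x => h3 x.2 x.1 x.1.2)
    (by
      simp only [Set.Icc.coe_zero, h2]
      exact continuous_const)
    (fun w => (h1 w).comp_continuous continuous_subtype_val fun t => t.2)
  refine ⟨fun w => γ w 1, hg.comp (.prodMk_right 1), fun w => ⟨?_, ?_⟩⟩
  · simpa using h3 w 1 (right_mem_Icc.2 zero_le_one)
  · have := hlip _ (γ w) 0 1 le_rfl zero_le_one le_rfl (h1 w) (h3 w)
    simpa [h2] using this

end Lifting

/-! ### Differentials, the inverse function theorem and lengths of curves. -/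

section Manifold

open Filter Topology Set Metric Manifold
open scoped ENNReal

variable {n k : ℕ}

section Smooth

variable {M : Type*} [TopologicalSpace M] [ChartedSpace (E n) M]

theorem differential_apply (F : M → E k) (x : M) (v : TangentSpace (𝓡 n) x) :
    differential F x v = mfderiv (𝓡 n) 𝓘(ℝ, E k) F x v := rfl

theorem differential_congr {F G : M → E k} {x : M} (h : F =ᶠ[𝓝 x] G) :
    differential (n := n) F x = differential G x := by
  ext1 v
  rw [differential_apply, differential_apply, h.mfderiv_eq]
  rfl

/-- The differential of a map read in the chart at the base point. -/
theorem differential_eq_fderiv {F : M → E k} {x : M}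
    (hF : MDifferentiableAt (𝓡 n) 𝓘(ℝ, E k) F x) (v : TangentSpace (𝓡 n) x) :
    differential F x v = fderiv ℝ (F ∘ (chartAt (E n) x).symm) (chartAt (E n) x x) v := by
  rw [differential_apply, hF.mfderiv]
  simp [writtenInExtChartAt]
  rfl

theorem differential_comp {m : ℕ} {F : M → E k} {g : E k → E m} {x : M}
    (hg : DifferentiableAt ℝ g (F x)) (hF : MDifferentiableAt (𝓡 n) 𝓘(ℝ, E k) F x)
    (v : TangentSpace (𝓡 n) x) :
    differential (fun y => g (F y)) x v = fderiv ℝ g (F x) (differential F x v) := by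
  have h := mfderiv_comp (I := 𝓡 n) (I' := 𝓘(ℝ, E k)) (I'' := 𝓘(ℝ, E m)) x
    hg.mdifferentiableAt hF
  rw [differential_apply, differential_apply]
  change mfderiv (𝓡 n) 𝓘(ℝ, E m) (g ∘ F) x v = _
  rw [h, mfderiv_eq_fderiv]
  rfl

/-- The inverse function theorem on manifolds. -/
theorem exists_local_inverse [IsManifold (𝓡 n) ∞ M] {F : M → E n}
    (hF : ContMDiff (𝓡 n) 𝓘(ℝ, E n) ∞ F) {x : M}
    (hinj : Function.Injective (differential (n := n) F x)) :
    ∃ e : OpenPartialHomeomorph M (E n), x ∈ e.source ∧ EqOn F e e.source ∧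
      ContMDiffAt 𝓘(ℝ, E n) (𝓡 n) ∞ e.symm (F x) := by
  set φ := chartAt (E n) x
  have hx : x ∈ φ.source := mem_chart_source (E n) x
  have hφ : ContMDiffAt 𝓘(ℝ, E n) (𝓡 n) ∞ φ.symm (φ x) :=
    contMDiffOn_chart_symm.contMDiffAt (φ.open_target.mem_nhds (φ.map_source hx))
  have hG : ContDiffAt ℝ ∞ (F ∘ φ.symm) (φ x) :=
    contMDiffAt_iff_contDiffAt.1 ((hF (φ.symm (φ x))).comp (φ x) hφ)
  have hGinj : Function.Injective (fderiv ℝ (F ∘ φ.symm) (φ x) : E n →ₗ[ℝ] E n) := by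
    intro v w hvw
    have hd := differential_eq_fderiv (hF.mdifferentiable (by simp) x)
    exact hinj ((hd v).trans (hvw.trans (hd w).symm))
  let G' : E n ≃L[ℝ] E n := (LinearEquiv.ofInjectiveEndo _ hGinj).toContinuousLinearEquiv
  have hG' : HasFDerivAt (F ∘ φ.symm) (G' : E n →L[ℝ] E n) (φ x) := by
    have : (G' : E n →L[ℝ] E n) = fderiv ℝ (F ∘ φ.symm) (φ x) := by
      ext v
      rfl
    rw [this]
    exact (hG.differentiableAt (by simp)).hasFDerivAt
  have hGx : (F ∘ φ.symm) (φ x) = F x := by rw [Function.comp_apply, φ.left_inv hx]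
  refine ⟨φ.trans (hG.toOpenPartialHomeomorph _ hG' (by simp)), ?_, ?_, ?_⟩
  · rw [OpenPartialHomeomorph.trans_source]
    exact ⟨hx, hG.mem_toOpenPartialHomeomorph_source hG' (by simp)⟩
  · intro y hy
    rw [OpenPartialHomeomorph.trans_source] at hy
    simp [φ.left_inv hy.1]
  · have hi : ContDiffAt ℝ ∞ (hG.toOpenPartialHomeomorph _ hG' (by simp)).symm (F x) := by
      have := hG.to_localInverse hG' (by simp)
      rwa [hGx] at this
    have hix : (hG.toOpenPartialHomeomorph _ hG' (by simp)).symm (F x) = φ x := by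
      have := hG.localInverse_apply_image hG' (by simp)
      rwa [hGx] at this
    have hi' := contMDiffAt_iff_contDiffAt.2 hi
    rw [← hix] at hφ
    exact hφ.comp (F x) hi'

end Smooth

section Length

variable {M : Type*} [MetricSpace M] [ChartedSpace (E n) M]
  [Bundle.RiemannianBundle (fun x : M => TangentSpace (𝓡 n) x)] [IsRiemannianManifold (𝓡 n) M]

theorem dist_le_of_speed_le {γ : ℝ → M} {a b C : ℝ} (hab : a ≤ b)
    (hγ : ContMDiffOn 𝓘(ℝ, ℝ) (𝓡 n) 1 γ (Icc a b))
    (hC : ∀ t ∈ Icc a b, ‖mfderivWithin 𝓘(ℝ, ℝ) (𝓡 n) γ (Icc a b) t 1‖ ≤ C) :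
    dist (γ a) (γ b) ≤ C * (b - a) := by
  have hC0 : 0 ≤ C := (norm_nonneg _).trans (hC a (left_mem_Icc.2 hab))
  have h1 := riemannianEDist_le_pathELength hγ rfl rfl hab
  rw [← IsRiemannianManifold.out (I := 𝓡 n), pathELength_eq_lintegral_mfderivWithin_Icc] at h1
  have h2 : edist (γ a) (γ b) ≤ ENNReal.ofReal (C * (b - a)) := by
    refine h1.trans ?_
    calc _ ≤ ∫⁻ _ in Icc a b, ENNReal.ofReal C := by
          refine MeasureTheory.setLIntegral_mono measurable_const fun t ht => ?_
          rw [← ofReal_norm]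
          exact ENNReal.ofReal_le_ofReal (hC t ht)
      _ = _ := by
        rw [MeasureTheory.setLIntegral_const, Real.volume_Icc, ENNReal.ofReal_mul hC0]
  rw [edist_dist] at h2
  exact (ENNReal.ofReal_le_ofReal_iff (mul_nonneg hC0 (by linarith))).1 h2

/-- The image of an almost minimizing curve is at most C times as long. The value C = 0 is allowed,
which later shows that the normal is constant. -/
theorem dist_map_le {F : M → E k} (hF : ContMDiff (𝓡 n) 𝓘(ℝ, E k) 1 F) {C : ℝ} (hC0 : 0 ≤ C)
    (hC : ∀ (x : M) (v : TangentSpace (𝓡 n) x), ‖differential F x v‖ ≤ C * ‖v‖) (x y : M) :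
    dist (F x) (F y) ≤ C * dist x y := by
  refine le_of_forall_pos_le_add fun ε hε => ?_
  have hlt : riemannianEDist (𝓡 n) x y < ENNReal.ofReal (dist x y + ε / (C + 1)) := by
    rw [← IsRiemannianManifold.out (I := 𝓡 n), edist_dist]
    exact (ENNReal.ofReal_lt_ofReal_iff (by positivity)).2 (by
      have : 0 < ε / (C + 1) := by positivity
      linarith)
  obtain ⟨γ, h0, h1, hγ, hlen⟩ := exists_lt_of_riemannianEDist_lt hlt
  have hFγ : ContMDiffOn 𝓘(ℝ, ℝ) 𝓘(ℝ, E k) 1 (F ∘ γ) (Icc 0 1) := hF.comp_contMDiffOn hγ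
  have h2 : edist (F x) (F y) ≤ pathELength 𝓘(ℝ, E k) (F ∘ γ) 0 1 := by
    rw [IsRiemannianManifold.out (I := 𝓘(ℝ, E k)) (F x) (F y)]
    exact riemannianEDist_le_pathELength hFγ (by simp [h0]) (by simp [h1]) zero_le_one
  have h3 : pathELength 𝓘(ℝ, E k) (F ∘ γ) 0 1 ≤ ENNReal.ofReal C * pathELength (𝓡 n) γ 0 1 := by
    rw [pathELength_eq_lintegral_mfderivWithin_Icc, pathELength_eq_lintegral_mfderivWithin_Icc,
      ← MeasureTheory.lintegral_const_mul' _ _ ENNReal.ofReal_ne_top]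
    refine MeasureTheory.setLIntegral_mono' measurableSet_Icc fun t ht => ?_
    have hu : UniqueMDiffWithinAt 𝓘(ℝ, ℝ) (Icc (0 : ℝ) 1) t :=
      (uniqueDiffOn_Icc zero_lt_one t ht).uniqueMDiffWithinAt
    rw [mfderiv_comp_mfderivWithin t (hF.mdifferentiable (by simp) _)
      ((hγ t ht).mdifferentiableWithinAt (by simp)) hu]
    rw [← ofReal_norm, ← ofReal_norm, ← ENNReal.ofReal_mul hC0]
    refine ENNReal.ofReal_le_ofReal ?_
    rw [norm_tangentSpace_vectorSpace]
    exact hC _ _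
  have h4 : edist (F x) (F y) ≤ ENNReal.ofReal (C * (dist x y + ε / (C + 1))) := by
    refine h2.trans (h3.trans ?_)
    rw [ENNReal.ofReal_mul hC0]
    gcongr
  rw [edist_dist, ENNReal.ofReal_le_ofReal_iff (by positivity)] at h4
  refine h4.trans ?_
  have : C * (ε / (C + 1)) ≤ ε := by
    rw [mul_div_assoc', div_le_iff₀ (by positivity)]
    nlinarith
  linarith

/-- Lifts of segments through a map with lower bounded differential are Lipschitz. -/
theorem dist_lift_le [IsManifold (𝓡 n) ∞ M] {F : M → E n}
    (hF : ContMDiff (𝓡 n) 𝓘(ℝ, E n) ∞ F) {Ω : Set M} {L : ℝ}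
    (hL : ∀ x ∈ Ω, ∀ v : TangentSpace (𝓡 n) x, ‖v‖ ≤ L * ‖differential F x v‖)
    {γ : ℝ → M} {a b : ℝ} (hab : a ≤ b) (hγ : ContinuousOn γ (Icc a b))
    (hΩ : ∀ t ∈ Icc a b, γ t ∈ Ω) {z w : E n} (hFγ : ∀ t ∈ Icc a b, F (γ t) = z + t • w) :
    dist (γ a) (γ b) ≤ L * ‖w‖ * (b - a) := by
  rcases hab.eq_or_lt with rfl | hab
  · simp
  -- The lift is only given as continuous, but locally it is a smooth inverse of `F` applied to a
  -- segment.
  have hsm : ContMDiffOn 𝓘(ℝ, ℝ) (𝓡 n) 1 γ (Icc a b) := by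
    intro t ht
    obtain ⟨e, he, hFe, hes⟩ := exists_local_inverse hF (x := γ t) (by
      rw [injective_iff_map_eq_zero]
      intro v hv
      have := hL _ (hΩ t ht) v
      rw [hv, norm_zero, mul_zero] at this
      exact norm_eq_zero.1 (le_antisymm this (norm_nonneg _)))
    rw [hFγ t ht] at hes
    have hline : ContMDiffAt 𝓘(ℝ, ℝ) 𝓘(ℝ, E n) ∞ (fun t : ℝ => z + t • w) t := by
      rw [contMDiffAt_iff_contDiffAt]
      fun_prop
    have hc := ((hes.comp t hline).of_le (m := 1) (by simp)).contMDiffWithinAt (s := Icc a b)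
    refine hc.congr_of_eventuallyEq ?_ ?_
    · have := (hγ t ht).eventually (e.open_source.mem_nhds he)
      filter_upwards [this, self_mem_nhdsWithin] with s hs1 hs2
      rw [Function.comp_apply, ← hFγ s hs2, hFe hs1, e.left_inv hs1]
    · rw [Function.comp_apply, ← hFγ t ht, hFe he, e.left_inv he]
  refine dist_le_of_speed_le hab.le hsm fun t ht => (hL _ (hΩ t ht) _).trans_eq ?_
  congr 2
  have hu : UniqueMDiffWithinAt 𝓘(ℝ, ℝ) (Icc a b) t :=
    (uniqueDiffOn_Icc hab t ht).uniqueMDiffWithinAt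
  have h1 := mfderiv_comp_mfderivWithin (I' := 𝓡 n) (I'' := 𝓘(ℝ, E n)) t
    (hF.mdifferentiable (by simp) (γ t)) ((hsm t ht).mdifferentiableWithinAt (by simp)) hu
  have h2 : mfderivWithin 𝓘(ℝ, ℝ) 𝓘(ℝ, E n) (F ∘ γ) (Icc a b) t =
      mfderivWithin 𝓘(ℝ, ℝ) 𝓘(ℝ, E n) (fun t : ℝ => z + t • w) (Icc a b) t :=
    mfderivWithin_congr (fun s hs => hFγ s hs) (hFγ t ht)
  rw [h1, mfderivWithin_eq_fderivWithin] at h2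
  have h3 := congrArg (fun A : ℝ →L[ℝ] E n => A 1) h2
  have h4 : HasDerivAt (fun t : ℝ => z + t • w) w t := (hasDerivAt_line w t).const_add z
  have h5 : fderivWithin ℝ (fun t : ℝ => z + t • w) (Icc a b) t 1 = w := by
    exact h4.hasDerivWithinAt.derivWithin (uniqueDiffOn_Icc hab t ht)
  exact h3.trans h5

end Length

end Manifold

/-! ### Orthogonal splitting of the ambient space along a unit vector. -/

section Frame

variable {n : ℕ}

theorem inner_normal_self {Y : Type*} {N : Y → E n} (hN : ∀ x, ‖N x‖ = 1) (x : Y) :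
    ⟪N x, N x⟫_ℝ = 1 := by
  rw [real_inner_self_eq_norm_sq, hN, one_pow]

/-- `J` is a linear isometry of `ℝⁿ` onto the hyperplane orthogonal to the unit vector `ν`. -/
structure IsFrame (ν : E (n + 1)) (J : E n →L[ℝ] E (n + 1)) : Prop where
  norm_eq_one : ‖ν‖ = 1
  isometric : ∀ v w, ⟪J v, J w⟫_ℝ = ⟪v, w⟫_ℝ
  orthogonal : ∀ v, ⟪J v, ν⟫_ℝ = 0
  decomp : ∀ y, J (ContinuousLinearMap.adjoint J y) + ⟪y, ν⟫_ℝ • ν = y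

theorem exists_isFrame {ν : E (n + 1)} (hν : ‖ν‖ = 1) : ∃ J : E n →L[ℝ] E (n + 1), IsFrame ν J := by
  have hν0 : ν ≠ 0 := fun h => by simp [h] at hν
  have : Fact (Module.finrank ℝ (E (n + 1)) = n + 1) := ⟨by simp⟩
  let b := OrthonormalBasis.fromOrthogonalSpanSingleton (𝕜 := ℝ) n hν0
  let J₀ : E n →ₗᵢ[ℝ] E (n + 1) := (ℝ ∙ ν)ᗮ.subtypeₗᵢ.comp b.repr.symm.toLinearIsometry
  let J : E n →L[ℝ] E (n + 1) := J₀.toContinuousLinearMap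
  have hiso : ∀ v w, ⟪J v, J w⟫_ℝ = ⟪v, w⟫_ℝ := J₀.inner_map_map
  have horth : ∀ v, ⟪J v, ν⟫_ℝ = 0 := fun v =>
    Submodule.mem_orthogonal_singleton_iff_inner_left.1 (b.repr.symm v).2
  refine ⟨J, hν, hiso, horth, fun y => ?_⟩
  have hy : y - ⟪y, ν⟫_ℝ • ν ∈ (ℝ ∙ ν)ᗮ := by
    rw [Submodule.mem_orthogonal_singleton_iff_inner_left, inner_sub_left, inner_smul_left,
      real_inner_self_eq_norm_sq, hν]
    simp
  have hJ : J (b.repr ⟨_, hy⟩) = y - ⟪y, ν⟫_ℝ • ν := by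
    change ((b.repr.symm (b.repr ⟨_, hy⟩) : (ℝ ∙ ν)ᗮ) : E (n + 1)) = _
    rw [LinearIsometryEquiv.symm_apply_apply]
  have hadj : ContinuousLinearMap.adjoint J y = b.repr ⟨_, hy⟩ := by
    refine ext_inner_right ℝ fun v => ?_
    rw [ContinuousLinearMap.adjoint_inner_left, ← hiso, hJ, inner_sub_left, inner_smul_left,
      real_inner_comm, real_inner_comm (J v) ν, horth]
    simp
  rw [hadj, hJ, sub_add_cancel]

namespace IsFrame

variable {ν : E (n + 1)} {J : E n →L[ℝ] E (n + 1)}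

theorem adjoint_apply (h : IsFrame ν J) (v : E n) : ContinuousLinearMap.adjoint J (J v) = v :=
  ext_inner_right ℝ fun w => by rw [ContinuousLinearMap.adjoint_inner_left, h.isometric]

theorem adjoint_normal (h : IsFrame ν J) : ContinuousLinearMap.adjoint J ν = 0 :=
  ext_inner_right ℝ fun w => by
    rw [ContinuousLinearMap.adjoint_inner_left, real_inner_comm, h.orthogonal, inner_zero_left]

theorem inner_self (h : IsFrame ν J) : ⟪ν, ν⟫_ℝ = 1 := by
  rw [real_inner_self_eq_norm_sq, h.norm_eq_one, one_pow]

theorem inner_add_smul (h : IsFrame ν J) (v w : E n) (s t : ℝ) :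
    ⟪J v + s • ν, J w + t • ν⟫_ℝ = ⟪v, w⟫_ℝ + s * t := by
  rw [inner_add_left, inner_add_right, inner_add_right, inner_smul_left, inner_smul_left,
    inner_smul_right, inner_smul_right, h.isometric, h.orthogonal, h.inner_self,
    real_inner_comm (J w) ν, h.orthogonal]
  simp

theorem inner_eq (h : IsFrame ν J) (y z : E (n + 1)) :
    ⟪y, z⟫_ℝ = ⟪ContinuousLinearMap.adjoint J y, ContinuousLinearMap.adjoint J z⟫_ℝ +
      ⟪y, ν⟫_ℝ * ⟪z, ν⟫_ℝ := by
  rw [← h.inner_add_smul, h.decomp, h.decomp]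

end IsFrame

end Frame

/-! ### Hypersurfaces as local graphs. -/

section Hypersurface

open Filter Topology Set Metric Manifold

variable {n : ℕ} {M : Type*} [TopologicalSpace M] [ChartedSpace (E n) M]

theorem finrank_tangentSpace (x : M) : Module.finrank ℝ (TangentSpace (𝓡 n) x) = n := by
  change Module.finrank ℝ (E n) = n
  simp

variable [Bundle.RiemannianBundle (fun x : M => TangentSpace (𝓡 n) x)] {X N : M → E (n + 1)}

theorem norm_differential (hX : IsIsometricImmersion X) (x : M) (v : TangentSpace (𝓡 n) x) :
    ‖differential X x v‖ = ‖v‖ := by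
  rw [@norm_eq_sqrt_real_inner (E (n + 1)), @norm_eq_sqrt_real_inner (TangentSpace (𝓡 n) x),
    hX.isometric]

/-- The projection of the tangent space to a hyperplane contracts at most by the cosine of the
angle. -/
theorem mul_norm_le_norm_proj (hX : IsIsometricImmersion X) (hN : IsUnitNormal X N) {ν : E (n + 1)}
    {J : E n →L[ℝ] E (n + 1)} (hJ : IsFrame ν J) (x : M) (v : TangentSpace (𝓡 n) x) :
    ⟪N x, ν⟫_ℝ * ‖v‖ ≤ ‖ContinuousLinearMap.adjoint J (differential X x v)‖ := by
  set y := differential X x v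
  set s := ⟪N x, ν⟫_ℝ
  have h1 := hJ.inner_eq y y
  have hNN : ⟪N x, N x⟫_ℝ = 1 := by rw [real_inner_self_eq_norm_sq, hN.norm_eq_one, one_pow]
  -- Since `y` is tangent, only the tangential part of `ν`, of squared length 1 - s², enters;
  -- Cauchy–Schwarz then bounds the lost component.
  have h2 : ⟪y, ν⟫_ℝ = ⟪y, ν - s • N x⟫_ℝ := by
    rw [inner_sub_right, inner_smul_right, hN.orthogonal x v]
    simp
  have h3 : ⟪ν - s • N x, ν - s • N x⟫_ℝ = 1 - s ^ 2 := by
    rw [inner_sub_left, inner_sub_right, inner_sub_right, inner_smul_left, inner_smul_left,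
      inner_smul_right, inner_smul_right, hJ.inner_self, hNN, real_inner_comm (N x) ν]
    simp only [conj_trivial]
    change 1 - s * s - (s * s - s * (s * 1)) = _
    ring
  have h4 := real_inner_mul_inner_self_le y (ν - s • N x)
  rw [← h2, h3] at h4
  have h5 : ⟪y, y⟫_ℝ = ‖v‖ ^ 2 := by
    rw [real_inner_self_eq_norm_sq, norm_differential hX]
  rw [real_inner_self_eq_norm_sq (ContinuousLinearMap.adjoint J y)] at h1
  rw [h5] at h1 h4
  refine abs_le_of_sq_le_sq' ?_ (norm_nonneg _) |>.2
  rw [mul_pow]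
  nlinarith

/-- The projection of the tangent space at `x` to the model space `ℝⁿ`, as a linear equivalence. -/
theorem exists_proj_equiv (hX : IsIsometricImmersion X) (hN : IsUnitNormal X N) {ν : E (n + 1)}
    {J : E n →L[ℝ] E (n + 1)} (hJ : IsFrame ν J) {x : M} (hx : 0 < ⟪N x, ν⟫_ℝ) :
    ∃ e : TangentSpace (𝓡 n) x ≃ₗ[ℝ] E n,
      ∀ v, e v = ContinuousLinearMap.adjoint J (differential X x v) := by
  let T : TangentSpace (𝓡 n) x →ₗ[ℝ] E n :=
    (ContinuousLinearMap.adjoint J).toLinearMap ∘ₗ differential X x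
  have hinj : Function.Injective T := by
    rw [injective_iff_map_eq_zero]
    intro v hv
    have h := mul_norm_le_norm_proj hX hN hJ x v
    have hv' : ContinuousLinearMap.adjoint J (differential X x v) = 0 := hv
    rw [hv', norm_zero] at h
    exact norm_eq_zero.1 (le_antisymm (by nlinarith [norm_nonneg v]) (norm_nonneg v))
  refine ⟨LinearEquiv.ofInjectiveOfFinrankEq T hinj ?_, fun v => rfl⟩
  rw [finrank_tangentSpace]
  simp

/-- A vector orthogonal to the normal is tangent. -/
theorem differential_adjoint (hX : IsIsometricImmersion X) (hN : IsUnitNormal X N) {x : M}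
    {y : E (n + 1)} (hy : ⟪y, N x⟫_ℝ = 0) :
    differential X x (LinearMap.adjoint (𝕜 := ℝ) (E := TangentSpace (𝓡 n) x) (F := E (n + 1))
      (differential X x) y) = y := by
  obtain ⟨J, hJ⟩ := exists_isFrame (hN.norm_eq_one x)
  obtain ⟨e, he⟩ := exists_proj_equiv hX hN hJ (x := x) (by
    rw [inner_normal_self hN.norm_eq_one]
    exact one_pos)
  set z := differential X x (LinearMap.adjoint (𝕜 := ℝ) (E := TangentSpace (𝓡 n) x)
    (F := E (n + 1)) (differential X x) y) - y with hz
  have hzN : ⟪z, N x⟫_ℝ = 0 := by rw [hz, inner_sub_left, hN.orthogonal, hy, sub_zero]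
  have hzX : ∀ v : TangentSpace (𝓡 n) x, ⟪z, differential X x v⟫_ℝ = 0 := by
    intro v
    rw [hz, inner_sub_left, hX.isometric, LinearMap.adjoint_inner_left, sub_self]
  have hzJ : ContinuousLinearMap.adjoint J z = 0 := by
    refine ext_inner_right ℝ fun u => ?_
    have h1 := hJ.inner_eq z (differential X x (e.symm u))
    rw [hzX, hzN, ← he, e.apply_symm_apply] at h1
    rw [inner_zero_left]
    linarith
  have := hJ.decomp z
  rw [hzJ, hzN, map_zero, zero_smul, add_zero] at this
  exact (sub_eq_zero.1 this.symm)

/-- The Weingarten equation. -/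
theorem differential_shape (hX : IsIsometricImmersion X) (hN : IsUnitNormal X N) {x : M}
    (hd : MDifferentiableAt (𝓡 n) 𝓘(ℝ, E (n + 1)) N x) (v : TangentSpace (𝓡 n) x) :
    differential X x (shape X N x v) = -differential N x v := by
  have h : ⟪differential N x v, N x⟫_ℝ = 0 := by
    -- The constant function |N|² is multiplied by a fixed vector because `differential` is set up
    -- for maps into `E k`.
    have hg : HasFDerivAt (fun y : E (n + 1) => ⟪y, y⟫_ℝ • N x)
        (((2 : ℝ) • innerSL ℝ (N x)).smulRight (N x)) (N x) := by
      have h1 : HasFDerivAt (fun y : E (n + 1) => ⟪y, y⟫_ℝ) ((2 : ℝ) • innerSL ℝ (N x)) (N x) := by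
        refine ((hasFDerivAt_id (N x)).inner ℝ (hasFDerivAt_id (N x))).congr_fderiv ?_
        ext u
        simp [real_inner_comm u, two_mul]
      exact h1.smul_const (N x)
    have h1 := differential_comp hg.differentiableAt hd v
    have h2 : (fun y => ⟪N y, N y⟫_ℝ • N x) = fun _ => N x := by
      funext y
      rw [inner_normal_self hN.norm_eq_one, one_smul]
    rw [h2, hg.fderiv, differential_apply, mfderiv_const] at h1
    have h3 : (2 * ⟪N x, differential N x v⟫_ℝ) • N x = 0 := h1.symm
    have hN0 : N x ≠ 0 := fun h0 => by simpa [h0] using hN.norm_eq_one x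
    rw [real_inner_comm]
    simpa [hN0] using h3
  rw [shape, LinearMap.neg_apply, map_neg, LinearMap.comp_apply, differential_adjoint hX hN h]

/-- Near `p` the hypersurface `X` with normal `N` is the graph of `f` over its tangent hyperplane,
which is parametrized by `J`. The map `F` is the projection to that hyperplane, with local
inverse `s`. -/
structure IsGraphAt (X N : M → E (n + 1)) (p : M) (J : E n →L[ℝ] E (n + 1)) (f : E n → ℝ)
    (F : M → E n) (s : E n → M) : Prop where
  frame : IsFrame (N p) J
  contDiffAt : ContDiffAt ℝ 3 f 0
  map_zero : f 0 = 0
  grad_zero : grad f 0 = 0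
  proj_base : F p = 0
  contMDiff_proj : ContMDiff (𝓡 n) 𝓘(ℝ, E n) ∞ F
  inv_zero : s 0 = p
  continuousAt_inv : ContinuousAt s 0
  proj_inv : ∀ᶠ w in 𝓝 0, F (s w) = w
  position : ∀ᶠ x in 𝓝 p, X x = X p + (J (F x) + f (F x) • N p)
  normal : ∀ᶠ x in 𝓝 p, N x = (areaFactor f (F x))⁻¹ • (N p - J (grad f (F x)))
  shape_conj : ∀ᶠ x in 𝓝 p, ∃ e : TangentSpace (𝓡 n) x ≃ₗ[ℝ] E n,
    ∀ v, e (shape X N x v) = fderiv ℝ (slope f) (F x) (e v)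
  shape_base : ∃ e : TangentSpace (𝓡 n) p ≃ₗᵢ[ℝ] E n,
    ∀ v, e (shape X N p v) = fderiv ℝ (grad f) 0 (e v)

theorem contMDiff_proj (hX : IsIsometricImmersion X) (J : E n →L[ℝ] E (n + 1)) (c : E (n + 1)) :
    ContMDiff (𝓡 n) 𝓘(ℝ, E n) ∞ fun x => ContinuousLinearMap.adjoint J (X x - c) := by
  have hg : ContDiff ℝ ∞ fun y => ContinuousLinearMap.adjoint J (y - c) :=
    (ContinuousLinearMap.adjoint J).contDiff.comp (contDiff_id.sub contDiff_const)
  exact hg.contMDiff.comp hX.smooth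

theorem differential_proj (hX : IsIsometricImmersion X) (J : E n →L[ℝ] E (n + 1)) (c : E (n + 1))
    (x : M) (v : TangentSpace (𝓡 n) x) :
    differential (fun x => ContinuousLinearMap.adjoint J (X x - c)) x v =
      ContinuousLinearMap.adjoint J (differential X x v) := by
  have hg : HasFDerivAt (fun y => ContinuousLinearMap.adjoint J (y - c))
      (ContinuousLinearMap.adjoint J) (X x) := by
    simp only [map_sub]
    exact (ContinuousLinearMap.adjoint J).hasFDerivAt.sub_const _
  rw [differential_comp (g := fun y => ContinuousLinearMap.adjoint J (y - c)) hg.differentiableAt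
    (hX.smooth.mdifferentiable (by simp) x), hg.fderiv]

/-- The unit normal of a graph. -/
theorem normal_eq_of_orthogonal {ν m : E (n + 1)} {J : E n →L[ℝ] E (n + 1)} (hJ : IsFrame ν J)
    {f : E n → ℝ} {w : E n} (hm : ⟪m, m⟫_ℝ = 1) (hpos : 0 < ⟪m, ν⟫_ℝ)
    (h : ∀ u, ⟪m, J u + (fderiv ℝ f w u) • ν⟫_ℝ = 0) :
    m = (areaFactor f w)⁻¹ • (ν - J (grad f w)) := by
  set b := ContinuousLinearMap.adjoint J m
  set t := ⟪m, ν⟫_ℝ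
  have hb : b = -(t • grad f w) := by
    refine ext_inner_right ℝ fun u => ?_
    have h1 := h u
    rw [← hJ.decomp m, hJ.inner_add_smul, ← inner_grad] at h1
    rw [inner_neg_left, inner_smul_left]
    simp only [conj_trivial]
    linarith
  have h1 := hJ.inner_eq m m
  change ⟪m, m⟫_ℝ = ⟪b, b⟫_ℝ + t * t at h1
  rw [hm, hb, inner_neg_neg, inner_smul_left, inner_smul_right] at h1
  simp only [conj_trivial] at h1
  have ht : t = (areaFactor f w)⁻¹ := by
    refine eq_inv_of_mul_eq_one_left ?_
    have h2 := areaFactor_sq f w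
    have h3 : (t * areaFactor f w) ^ 2 = 1 := by
      rw [mul_pow, h2]
      linear_combination -h1
    have h4 : 0 < t * areaFactor f w := mul_pos hpos (areaFactor_pos f w)
    nlinarith
  have hd := hJ.decomp m
  change J b + t • ν = m at hd
  rw [← hd, hb, ← ht, map_neg, map_smul, smul_sub]
  abel

/-- Projection to the tangent hyperplane at p is locally invertible, and the height over it is f.
The normal is only assumed continuous; its differentiability is a consequence of the graph formula.
-/
theorem exists_isGraphAt [IsManifold (𝓡 n) ∞ M] (hX : IsIsometricImmersion X)
    (hN : IsUnitNormal X N) (p : M) : ∃ J f F s, IsGraphAt X N p J f F s := by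
  obtain ⟨J, hJ⟩ := exists_isFrame (hN.norm_eq_one p)
  set F : M → E n := fun x => ContinuousLinearMap.adjoint J (X x - X p) with hF
  have hFs : ContMDiff (𝓡 n) 𝓘(ℝ, E n) ∞ F := contMDiff_proj hX J (X p)
  have hdF : ∀ (x : M) (v : TangentSpace (𝓡 n) x), differential F x v =
      ContinuousLinearMap.adjoint J (differential X x v) := differential_proj hX J (X p)
  have hF0 : F p = 0 := by simp [hF]
  have hpp : ⟪N p, N p⟫_ℝ = 1 := hJ.inner_self
  obtain ⟨e, hpe, hFe, hes⟩ := exists_local_inverse hFs (x := p) (by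
    obtain ⟨e, he⟩ := exists_proj_equiv hX hN hJ (x := p) (by rw [hpp]; exact one_pos)
    intro v w hvw
    rw [hdF, hdF, ← he, ← he] at hvw
    exact e.injective hvw)
  rw [hF0] at hes
  have hep : e p = 0 := by rw [← hFe hpe, hF0]
  have hs0 : e.symm 0 = p := by rw [← hep, e.left_inv hpe]
  set f : E n → ℝ := fun w => ⟪X (e.symm w) - X p, N p⟫_ℝ with hf
  have hf3 : ContDiffAt ℝ 3 f 0 := by
    have h1 : ContMDiffAt 𝓘(ℝ, E n) 𝓘(ℝ, E (n + 1)) ∞ (fun w => X (e.symm w)) 0 :=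
      (hX.smooth _).comp (0 : E n) hes
    have h2 : ContDiffAt ℝ ∞ (fun w => X (e.symm w)) 0 := contMDiffAt_iff_contDiffAt.1 h1
    exact contDiffAt_infty.1 ((h2.sub contDiffAt_const).inner ℝ contDiffAt_const) 3
  have hFc : ContinuousAt F p := hFs.continuous.continuousAt
  have hFt : Tendsto F (𝓝 p) (𝓝 0) := by
    have := hFc.tendsto
    rwa [hF0] at this
  have hpos : ∀ᶠ x in 𝓝 p, X x = X p + (J (F x) + f (F x) • N p) := by
    filter_upwards [e.open_source.mem_nhds hpe] with x hx
    have h1 : e.symm (F x) = x := by rw [hFe hx, e.left_inv hx]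
    have h2 := hJ.decomp (X x - X p)
    simp only [hf, h1]
    rw [h2]
    abel
  -- Continuity of the normal is what selects the sign among the two unit normals of the graph.
  have hnor0 : ∀ᶠ x in 𝓝 p, 0 < ⟪N x, N p⟫_ℝ := by
    have : Tendsto (fun x => ⟪N x, N p⟫_ℝ) (𝓝 p) (𝓝 ⟪N p, N p⟫_ℝ) :=
      (hN.continuous.inner continuous_const).tendsto p
    exact this.eventually (lt_mem_nhds (by rw [hpp]; exact one_pos))
  have hf3' : ∀ᶠ x in 𝓝 p, ContDiffAt ℝ 3 f (F x) := hFt.eventually (hf3.eventually (by simp))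
  have hnor : ∀ᶠ x in 𝓝 p, N x = (areaFactor f (F x))⁻¹ • (N p - J (grad f (F x))) := by
    filter_upwards [hpos.eventually_nhds, hnor0, hf3'] with x hx1 hx2 hx3
    refine normal_eq_of_orthogonal hJ (inner_normal_self hN.norm_eq_one x) hx2 fun u => ?_
    obtain ⟨e', he'⟩ := exists_proj_equiv hX hN hJ hx2
    have hg : HasFDerivAt (fun w => X p + (J w + f w • N p))
        (J + (fderiv ℝ f (F x)).smulRight (N p)) (F x) :=
      (J.hasFDerivAt.add ((hx3.differentiableAt (by simp)).hasFDerivAt.smul_const (N p))).const_add _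
    have h1 := differential_comp hg.differentiableAt (hFs.mdifferentiable (by simp) x) (e'.symm u)
    have h2 : differential X x (e'.symm u) = J u + (fderiv ℝ f (F x) u) • N p := by
      rw [differential_congr hx1, h1, hg.fderiv, hdF, ← he', e'.apply_symm_apply]
      rfl
    rw [← h2, real_inner_comm]
    exact hN.orthogonal x _
  -- The tangential part of the graph normal is minus the slope, so the projected Weingarten
  -- equation conjugates the shape operator to the derivative of the slope.
  have hsh : ∀ᶠ x in 𝓝 p, ∀ v : TangentSpace (𝓡 n) x,
      ContinuousLinearMap.adjoint J (differential X x (shape X N x v)) =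
        fderiv ℝ (slope f) (F x) (ContinuousLinearMap.adjoint J (differential X x v)) := by
    filter_upwards [hnor.eventually_nhds, hf3'] with x hx1 hx3
    intro v
    have hgd : DifferentiableAt ℝ (fun w => (areaFactor f w)⁻¹ • (N p - J (grad f w))) (F x) := by
      refine ((contDiffAt_areaFactor_inv hx3).differentiableAt (by simp)).smul ?_
      exact (J.differentiableAt.comp _
        ((contDiffAt_grad hx3).differentiableAt (by simp))).const_sub _
    have hFd := hFs.mdifferentiable (by simp) x
    have hNd : MDifferentiableAt (𝓡 n) 𝓘(ℝ, E (n + 1)) N x :=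
      (hgd.mdifferentiableAt.comp x hFd).congr_of_eventuallyEq hx1
    rw [differential_shape hX hN hNd, differential_congr hx1, differential_comp hgd hFd, map_neg,
      hdF]
    have h1 : (fun w => ContinuousLinearMap.adjoint J
        ((areaFactor f w)⁻¹ • (N p - J (grad f w)))) = fun w => -slope f w := by
      funext w
      rw [map_smul, map_sub, hJ.adjoint_normal, hJ.adjoint_apply, zero_sub, smul_neg]
      rfl
    have h2 := ((ContinuousLinearMap.adjoint J).hasFDerivAt.comp (F x) hgd.hasFDerivAt).fderiv
    have h3 : fderiv ℝ (fun w => ContinuousLinearMap.adjoint J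
        ((areaFactor f w)⁻¹ • (N p - J (grad f w)))) (F x) = _ := h2
    rw [h1, fderiv_fun_neg] at h3
    have h4 := congrArg (fun L => L (ContinuousLinearMap.adjoint J (differential X x v))) h3
    simp only [neg_apply, ContinuousLinearMap.comp_apply] at h4
    rw [← h4, neg_neg]
  have hg0 : grad f 0 = 0 := by
    have h1 := congrArg (ContinuousLinearMap.adjoint J) hnor.self_of_nhds
    rw [map_smul, map_sub, hJ.adjoint_normal, hJ.adjoint_apply, zero_sub, hF0] at h1
    have h2 := (areaFactor_pos f 0).ne'
    simpa [h2] using h1.symm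
  refine ⟨J, f, F, e.symm, hJ, hf3, by simp [hf, hs0], hg0, hF0, hFs, hs0, hes.continuousAt, ?_,
    hpos, hnor, ?_, ?_⟩
  · have h0 : (0 : E n) ∈ e.target := hep ▸ e.map_source hpe
    filter_upwards [e.open_target.mem_nhds h0] with w hw
    rw [hFe (e.map_target hw), e.right_inv hw]
  · filter_upwards [hsh, hnor0] with x hx1 hx2
    obtain ⟨e', he'⟩ := exists_proj_equiv hX hN hJ hx2
    exact ⟨e', fun v => by rw [he', he', hx1]⟩
  · obtain ⟨e', he'⟩ := exists_proj_equiv hX hN hJ (x := p) (by rw [hpp]; exact one_pos)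
    refine ⟨⟨e', fun v => ?_⟩, fun v => ?_⟩
    · have h1 := hJ.inner_eq (differential X p v) (differential X p v)
      rw [hN.orthogonal, ← he', real_inner_self_eq_norm_sq, real_inner_self_eq_norm_sq,
        norm_differential hX, zero_mul, add_zero] at h1
      exact ((sq_eq_sq₀ (norm_nonneg _) (norm_nonneg _)).1 h1).symm
    · have h1 := hsh.self_of_nhds v
      rw [← he', ← he', hF0, fderiv_slope_zero hf3 hg0] at h1
      exact h1

end Hypersurface

/-! ### Operator bound from the trace norm. -/

section NormBound

variable {V : Type*} [NormedAddCommGroup V] [InnerProductSpace ℝ V] [FiniteDimensional ℝ V]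
  {A : V →ₗ[ℝ] V} {n : ℕ}

theorem norm_apply_le (hA : A.IsSymmetric) (hn : Module.finrank ℝ V = n) {L : ℝ}
    (hL0 : 0 ≤ L) (hL : traceNormSq A ≤ L) (v : V) : ‖A v‖ ≤ (1 + L) * ‖v‖ := by
  set b := hA.eigenvectorBasis hn
  have h1 : ∀ i, ⟪b i, A v⟫_ℝ = hA.eigenvalues hn i * ⟪b i, v⟫_ℝ := fun i => by
    rw [← hA, hA.apply_eigenvectorBasis, inner_smul_left]
    simp
    exact Or.inl rfl
  refine abs_le_of_sq_le_sq' ?_ (by positivity) |>.2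
  rw [← b.sum_sq_inner_right, mul_pow, ← b.sum_sq_inner_right v, Finset.mul_sum]
  refine Finset.sum_le_sum fun i _ => ?_
  rw [h1, mul_pow]
  refine mul_le_mul_of_nonneg_right ?_ (sq_nonneg _)
  exact sq_le_sq' (by linarith [(abs_le.1 (eigenvalue_abs_le hA hn hL i)).1])
    (abs_le.1 (eigenvalue_abs_le hA hn hL i)).2

end NormBound

/-! ### Regularity of the normal and geometric quantities in graph coordinates. -/

section Hypersurface

open Filter Topology Set Metric Manifold

variable {n : ℕ}

section Regularity

variable {M : Type*} [TopologicalSpace M] [ChartedSpace (E n) M]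
  [Bundle.RiemannianBundle (fun x : M => TangentSpace (𝓡 n) x)] {X N : M → E (n + 1)}

namespace IsGraphAt

variable {p : M} {J : E n →L[ℝ] E (n + 1)} {f : E n → ℝ} {F : M → E n} {s : E n → M}

theorem tendsto_inv (h : IsGraphAt X N p J f F s) : Tendsto s (𝓝 0) (𝓝 p) := by
  have := h.continuousAt_inv.tendsto
  rwa [h.inv_zero] at this

theorem contMDiffAt_normal (h : IsGraphAt X N p J f F s) :
    ContMDiffAt (𝓡 n) 𝓘(ℝ, E (n + 1)) 1 N p := by
  have hg : ContDiffAt ℝ 1 (fun w => (areaFactor f w)⁻¹ • (N p - J (grad f w))) (F p) := by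
    rw [h.proj_base]
    refine ((contDiffAt_areaFactor_inv h.contDiffAt).of_le (by norm_num)).smul ?_
    exact contDiffAt_const.sub (J.contDiff.contDiffAt.comp _
      ((contDiffAt_grad h.contDiffAt).of_le (by norm_num)))
  exact (hg.contMDiffAt.comp p ((h.contMDiff_proj p).of_le (by simp))).congr_of_eventuallyEq
    h.normal

theorem isSymmetric_shape (h : IsGraphAt X N p J f F s) : (shape X N p).IsSymmetric := by
  obtain ⟨e, he⟩ := h.shape_base
  intro v w
  rw [← e.inner_map_map, he, inner_fderiv_grad_comm h.contDiffAt, real_inner_comm, ← he,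
    e.inner_map_map]

theorem shape_conj_inv (h : IsGraphAt X N p J f F s) : ∀ᶠ w in 𝓝 0,
    ∃ e : TangentSpace (𝓡 n) (s w) ≃ₗ[ℝ] E n,
      ∀ v, e (shape X N (s w) v) = (fderiv ℝ (slope f) w : E n →ₗ[ℝ] E n) (e v) := by
  filter_upwards [h.proj_inv, h.tendsto_inv.eventually h.shape_conj] with w hw1 ⟨e, he⟩
  exact ⟨e, fun v => by rw [he, hw1]; rfl⟩

theorem inner_position_normal (h : IsGraphAt X N p J f F s) : ∀ᶠ w in 𝓝 0,
    ⟪X (s w), N (s w)⟫_ℝ = -(supportFun f (ContinuousLinearMap.adjoint J (X p)) ⟪X p, N p⟫_ℝ w /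
      areaFactor f w) := by
  filter_upwards [h.proj_inv, h.tendsto_inv.eventually h.position,
    h.tendsto_inv.eventually h.normal] with w hw1 hw2 hw3
  rw [hw2, hw3, hw1]
  have h1 := h.frame.inner_add_smul (ContinuousLinearMap.adjoint J (X p) + w) (-grad f w)
    (⟪X p, N p⟫_ℝ + f w) 1
  have h2 : X p + (J w + f w • N p) = J (ContinuousLinearMap.adjoint J (X p) + w) +
      (⟪X p, N p⟫_ℝ + f w) • N p := by
    conv_lhs => rw [← h.frame.decomp (X p)]
    rw [map_add, add_smul]
    abel
  have h3 : N p - J (grad f w) = J (-grad f w) + (1 : ℝ) • N p := by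
    rw [map_neg, one_smul]
    abel
  rw [h2, h3, inner_smul_right, h1, supportFun, inner_neg_right, real_inner_comm]
  field_simp
  ring

theorem inner_sub_sub (h : IsGraphAt X N p J f F s) (z : E (n + 1)) : ∀ᶠ w in 𝓝 0,
    ⟪X (s w) - z, X (s w) - z⟫_ℝ =
      sqDist f (ContinuousLinearMap.adjoint J (X p - z)) ⟪X p - z, N p⟫_ℝ w := by
  filter_upwards [h.proj_inv, h.tendsto_inv.eventually h.position] with w hw1 hw2
  have h2 : X p + (J w + f w • N p) - z = J (ContinuousLinearMap.adjoint J (X p - z) + w) +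
      (⟪X p - z, N p⟫_ℝ + f w) • N p := by
    have := h.frame.decomp (X p - z)
    calc _ = (X p - z) + (J w + f w • N p) := by abel
      _ = _ := by
        conv_lhs => rw [← this]
        rw [map_add, add_smul]
        abel
  rw [hw2, hw1, h2, h.frame.inner_add_smul, sqDist]

end IsGraphAt

variable [IsManifold (𝓡 n) ∞ M]

theorem contMDiff_normal (hX : IsIsometricImmersion X) (hN : IsUnitNormal X N) :
    ContMDiff (𝓡 n) 𝓘(ℝ, E (n + 1)) 1 N := fun p => by
  obtain ⟨J, f, F, s, h⟩ := exists_isGraphAt hX hN p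
  exact h.contMDiffAt_normal

theorem isSymmetric_shape (hX : IsIsometricImmersion X) (hN : IsUnitNormal X N) (p : M) :
    (shape X N p).IsSymmetric := by
  obtain ⟨J, f, F, s, h⟩ := exists_isGraphAt hX hN p
  exact h.isSymmetric_shape

theorem norm_differential_normal (hX : IsIsometricImmersion X) (hN : IsUnitNormal X N) (p : M)
    (v : TangentSpace (𝓡 n) p) : ‖differential N p v‖ = ‖shape X N p v‖ := by
  rw [← norm_differential hX, differential_shape hX hN
    ((contMDiff_normal hX hN).mdifferentiable (by simp) p), norm_neg]

/-- Away from the base point the conjugation to graph coordinates is not isometric; tr(A²) is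
invariant under it and equals tr(AᵗA) because A is symmetric. -/
theorem continuous_traceNormSq_shape (hX : IsIsometricImmersion X) (hN : IsUnitNormal X N) :
    Continuous fun x => traceNormSq (shape X N x) := by
  refine continuous_iff_continuousAt.2 fun p => ?_
  obtain ⟨J, f, F, s, h⟩ := exists_isGraphAt hX hN p
  have h1 : ∀ᶠ x in 𝓝 p, traceNormSq (shape X N x) =
      LinearMap.trace ℝ (E n) ((fderiv ℝ (slope f) (F x) : E n →ₗ[ℝ] E n) ∘ₗ
        (fderiv ℝ (slope f) (F x) : E n →ₗ[ℝ] E n)) := by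
    filter_upwards [h.shape_conj] with x ⟨e, he⟩
    rw [traceNormSq_of_isSymmetric (isSymmetric_shape hX hN x)]
    exact trace_sq_congr e he
  refine ContinuousAt.congr ?_ (h1.mono fun x hx => hx.symm)
  have h2 : ContinuousAt (fun w => fderiv ℝ (slope f) w) (F p) := by
    rw [h.proj_base]
    exact ((contDiffAt_slope h.contDiffAt).fderiv_right (m := 1) (by norm_num)).continuousAt
  have h3 : ContinuousAt (fun x => fderiv ℝ (slope f) (F x)) p :=
    h2.comp h.contMDiff_proj.continuous.continuousAt
  let T : (E n →L[ℝ] E n) →ₗ[ℝ] ℝ :=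
    LinearMap.trace ℝ (E n) ∘ₗ ContinuousLinearMap.coeLM ℝ
  have hT : Continuous T := T.continuous_of_finiteDimensional
  exact hT.continuousAt.comp (h3.clm_comp h3)

end Regularity

end Hypersurface

/-! ### Graph patches of uniform size. -/

section Hypersurface

open Filter Topology Set Metric Manifold

variable {n : ℕ} {M : Type*}

theorem injective_differential [TopologicalSpace M] [ChartedSpace (E n) M]
    [Bundle.RiemannianBundle (fun x : M => TangentSpace (𝓡 n) x)] {k : ℕ} {F : M → E k} {x : M}
    {L : ℝ} (hL : ∀ v : TangentSpace (𝓡 n) x, ‖v‖ ≤ L * ‖differential F x v‖) :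
    Function.Injective (differential (n := n) F x) := by
  rw [injective_iff_map_eq_zero]
  intro v hv
  have := hL v
  rw [hv, norm_zero, mul_zero] at this
  exact norm_eq_zero.1 (le_antisymm this (norm_nonneg _))

variable [MetricSpace M] [ChartedSpace (E n) M]
  [Bundle.RiemannianBundle (fun x : M => TangentSpace (𝓡 n) x)] [IsRiemannianManifold (𝓡 n) M]
  {X N : M → E (n + 1)}

theorem dist_map_le_dist (hX : IsIsometricImmersion X) (x y : M) : dist (X x) (X y) ≤ dist x y := by
  have := dist_map_le (hX.smooth.of_le (by simp)) zero_le_one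
    (fun x v => by rw [norm_differential hX, one_mul]) x y
  rwa [one_mul] at this

variable [IsManifold (𝓡 n) ∞ M]

/-- A section over a set `S` of a map whose differential is bounded from below on an open set
containing the relevant complete balls. -/
theorem exists_section_of_le_norm_differential {F : M → E n}
    (hF : ContMDiff (𝓡 n) 𝓘(ℝ, E n) ∞ F) {Ω : Set M} (hΩ : IsOpen Ω) {L : ℝ}
    (hL : ∀ x ∈ Ω, ∀ v : TangentSpace (𝓡 n) x, ‖v‖ ≤ L * ‖differential F x v‖)
    {p : M} (hp : p ∈ Ω) [CompleteSpace M] {S : Set (E n)}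
    (hS : ∀ w ∈ S, closedBall p (L * ‖w - F p‖) ⊆ Ω) :
    ∃ s : S → M, Continuous s ∧ ∀ w : S, F (s w) = w ∧ dist p (s w) ≤ L * ‖(w : E n) - F p‖ ∧
      ∀ᶠ x in 𝓝 (s w), ∀ h : F x ∈ S, s ⟨F x, h⟩ = x := by
  have hloc : IsLocalHomeomorph fun y : Ω => F y := by
    have h1 : IsLocalHomeomorphOn F Ω := by
      refine IsLocalHomeomorphOn.mk F Ω fun x hx => ?_
      obtain ⟨e, he, hFe, -⟩ := exists_local_inverse hF (injective_differential (hL x hx))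
      exact ⟨e, he, hFe⟩
    rw [isLocalHomeomorph_iff_isLocalHomeomorphOn_univ]
    exact h1.comp hΩ.isOpenEmbedding_subtypeVal.isLocalHomeomorph.isLocalHomeomorphOn
      fun y _ => y.2
  have h := exists_section hloc ⟨p, hp⟩ (L := L) (S := S) (fun w hw => ?_)
    (fun w γ a b ha hab hb hγ hFγ => ?_)
  · obtain ⟨s, hs, hs'⟩ := h
    refine ⟨fun w => s w, continuous_subtype_val.comp hs, fun w => ⟨(hs' w).1, (hs' w).2, ?_⟩⟩
    obtain ⟨e, he, hFe, -⟩ := exists_local_inverse hF (injective_differential (hL _ (s w).2))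
    have h1 : ∀ᶠ w' in 𝓝 w, (s w' : M) ∈ e.source :=
      (continuous_subtype_val.comp hs).continuousAt.eventually (e.open_source.mem_nhds he)
    rw [nhds_subtype_eq_comap, eventually_comap, ← (hs' w).1] at h1
    filter_upwards [hF.continuous.continuousAt.eventually h1, e.open_source.mem_nhds he]
      with x hx1 hx2 hx3
    have h2 := hx1 ⟨F x, hx3⟩ rfl
    refine e.injOn h2 hx2 ?_
    rw [← hFe h2, ← hFe hx2]
    exact (hs' ⟨F x, hx3⟩).1
  -- The open set `Ω` need not be complete, but the balls used are closed balls of `M` contained in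
  -- it.
  · have hemb : IsUniformInducing (Subtype.val : Ω → M) := isUniformEmbedding_subtype_val.1
    rw [← hemb.isComplete_iff]
    have : Subtype.val '' closedBall (⟨p, hp⟩ : Ω) (L * ‖w - F p‖) =
        closedBall p (L * ‖w - F p‖) := by
      ext x
      constructor
      · rintro ⟨y, hy, rfl⟩
        exact hy
      · intro hx
        exact ⟨⟨x, hS w hw hx⟩, hx, rfl⟩
    rw [this]
    exact isClosed_closedBall.isComplete
  · exact dist_lift_le hF hL hab (continuous_subtype_val.comp_continuousOn hγ)
      (fun t _ => (γ t).2) hFγ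

theorem dist_normal_le (hX : IsIsometricImmersion X) (hN : IsUnitNormal X N) {Λ : ℝ} (hΛ0 : 0 ≤ Λ)
    (hΛ : ∀ x, traceNormSq (shape X N x) ≤ Λ) (x y : M) :
    dist (N x) (N y) ≤ (1 + Λ) * dist x y :=
  dist_map_le (contMDiff_normal hX hN) (by linarith) (fun x v => by
    rw [norm_differential_normal hX hN]
    exact norm_apply_le (isSymmetric_shape hX hN x) (finrank_tangentSpace x) hΛ0 (hΛ x) v) x y

/-- Near every point a hypersurface with bounded second fundamental form is a graph over a ball of
uniform size in the tangent space. -/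
theorem exists_section_closedBall [CompleteSpace M] (hX : IsIsometricImmersion X)
    (hN : IsUnitNormal X N) {C : ℝ} (hC : 1 ≤ C) (hNC : ∀ x y, dist (N x) (N y) ≤ C * dist x y)
    {p : M} {J : E n →L[ℝ] E (n + 1)} (hJ : IsFrame (N p) J) :
    ∃ s : closedBall (0 : E n) (1 / (4 * C)) → M, Continuous s ∧
      ∀ w, ContinuousLinearMap.adjoint J (X (s w) - X p) = w ∧ dist p (s w) ≤ 2 * ‖(w : E n)‖ ∧
        ∀ᶠ x in 𝓝 (s w), ∀ h : ContinuousLinearMap.adjoint J (X x - X p) ∈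
          closedBall (0 : E n) (1 / (4 * C)), s ⟨_, h⟩ = x := by
  have hC0 : 0 < C := by linarith
  have hF := contMDiff_proj hX J (X p)
  have hFp : ContinuousLinearMap.adjoint J (X p - X p) = 0 := by simp
  have h := exists_section_of_le_norm_differential hF (Ω := ball p (1 / C)) isOpen_ball (L := 2)
    (fun x hx v => ?_) (mem_ball_self (by positivity)) (S := closedBall (0 : E n) (1 / (4 * C)))
    (fun w hw => closedBall_subset_ball ?_)
  · simpa only [hFp, sub_zero] using h
  · have h1 := mul_norm_le_norm_proj hX hN hJ x v
    -- Within distance 1/C the normal moves by at most 1, so |N x - N p|² = 2 - 2⟨N x, N p⟩ gives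
    -- the lower bound, hence the distortion factor 2.
    have h2 : 1 / 2 ≤ ⟪N x, N p⟫_ℝ := by
      have h3 : ‖N x - N p‖ ≤ 1 := by
        rw [← dist_eq_norm]
        refine (hNC x p).trans ?_
        rw [mem_ball, lt_div_iff₀ hC0] at hx
        linarith
      have h4 := norm_sub_sq_real (N x) (N p)
      rw [hN.norm_eq_one, hN.norm_eq_one] at h4
      nlinarith [norm_nonneg (N x - N p)]
    rw [differential_proj hX]
    nlinarith [norm_nonneg v]
  · rw [hFp, sub_zero]
    have h1 := mem_closedBall_zero_iff.1 hw
    have h2 : 2 * (1 / (4 * C)) = 1 / C / 2 := by field_simp; norm_num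
    have h3 : 0 < 1 / C := by positivity
    linarith

end Hypersurface

/-! ### The penalized maximum principle. -/

section Hypersurface

open Filter Topology Set Metric Manifold

variable {n : ℕ}

theorem IsFrame.norm_adjoint_le {ν : E (n + 1)} {J : E n →L[ℝ] E (n + 1)} (h : IsFrame ν J)
    (y : E (n + 1)) : ‖ContinuousLinearMap.adjoint J y‖ ≤ ‖y‖ := by
  have h1 := h.inner_eq y y
  rw [real_inner_self_eq_norm_sq, real_inner_self_eq_norm_sq] at h1
  refine abs_le_of_sq_le_sq' ?_ (norm_nonneg _) |>.2
  nlinarith [mul_self_nonneg ⟪y, ν⟫_ℝ]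

variable {M : Type*} [MetricSpace M] [ChartedSpace (E n) M]
  [Bundle.RiemannianBundle (fun x : M => TangentSpace (𝓡 n) x)] [IsRiemannianManifold (𝓡 n) M]
  {X N : M → E (n + 1)} [IsManifold (𝓡 n) ∞ M]

/-- A penalized maximum principle: a bounded continuous function on a complete hypersurface with
bounded second fundamental form attains local maxima after subtraction of small multiples of
squared extrinsic distances, with almost the largest possible value. -/
theorem exists_isLocalMax_penalized [CompleteSpace M] [Nonempty M] (hX : IsIsometricImmersion X)
    (hN : IsUnitNormal X N) {C : ℝ} (hC : 1 ≤ C) (hNC : ∀ x y, dist (N x) (N y) ≤ C * dist x y)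
    {φ : M → ℝ} (hφ : Continuous φ) {B : ℝ} (hB : ∀ x, φ x ≤ B) {η : ℝ} (hη : 0 < η) :
    ∃ p x₀ : M, ‖X x₀ - X p‖ ≤ 1 ∧
      IsLocalMax (fun x => φ x - η * ⟪X x, X x⟫_ℝ - η * ⟪X x - X p, X x - X p⟫_ℝ) x₀ ∧
      ∀ x, φ x - η * ⟪X x, X x⟫_ℝ ≤ φ x₀ + η := by
  set g : M → ℝ := fun x => φ x - η * ⟪X x, X x⟫_ℝ with hg
  set ρ := 1 / (4 * C) with hρ
  have hρ0 : 0 < ρ := by positivity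
  have hρ1 : 2 * ρ ≤ 1 := by
    rw [hρ, ← mul_div_assoc, div_le_one (by positivity)]
    linarith
  have hbdd : BddAbove (range g) := ⟨B, by
    rintro _ ⟨x, rfl⟩
    have := mul_nonneg hη.le (real_inner_self_nonneg (x := X x))
    linarith [hB x]⟩
  -- The defect ηρ² is what the second penalty costs on the boundary of the patch, which keeps the
  -- maximum off the boundary.
  obtain ⟨p, hp⟩ : ∃ p, ∀ x, g x < g p + η * ρ ^ 2 := by
    obtain ⟨p, hp⟩ := exists_lt_of_lt_ciSup (show (⨆ x, g x) - η * ρ ^ 2 < ⨆ x, g x by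
      have : 0 < η * ρ ^ 2 := by positivity
      linarith)
    exact ⟨p, fun x => by linarith [le_ciSup hbdd x]⟩
  set h : M → ℝ := fun x => g x - η * ⟪X x - X p, X x - X p⟫_ℝ with hh
  have hXc := hX.smooth.continuous
  have hhc : Continuous h := by fun_prop
  obtain ⟨J, hJ⟩ := exists_isFrame (hN.norm_eq_one p)
  obtain ⟨s, hs, hs'⟩ := exists_section_closedBall hX hN hC hNC hJ
  have hne : Nonempty (closedBall (0 : E n) ρ) := ⟨⟨0, mem_closedBall_self hρ0.le⟩⟩
  obtain ⟨w, -, hw⟩ := isCompact_univ.exists_isMaxOn (α := ℝ) univ_nonempty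
    (hhc.comp hs).continuousOn
  have hs0 : s ⟨0, mem_closedBall_self hρ0.le⟩ = p := by
    have := (hs' ⟨0, mem_closedBall_self hρ0.le⟩).2.1
    rw [norm_zero, mul_zero] at this
    exact (dist_le_zero.1 this).symm
  have hge : g p ≤ h (s w) := by
    have h1 : h (s ⟨0, mem_closedBall_self hρ0.le⟩) ≤ h (s w) := hw (mem_univ _)
    rw [hs0] at h1
    simpa [hh] using h1
  have hwlt : ‖(w : E n)‖ < ρ := by
    refine lt_of_le_of_ne (mem_closedBall_zero_iff.1 w.2) fun heq => ?_
    have h1 := hJ.norm_adjoint_le (X (s w) - X p)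
    rw [(hs' w).1, heq] at h1
    have h2 : ρ ^ 2 ≤ ⟪X (s w) - X p, X (s w) - X p⟫_ℝ := by
      rw [real_inner_self_eq_norm_sq]
      gcongr
    have h3 := mul_le_mul_of_nonneg_left h2 hη.le
    have h4 := hp (s w)
    have h5 : h (s w) = g (s w) - η * ⟪X (s w) - X p, X (s w) - X p⟫_ℝ := rfl
    linarith
  refine ⟨p, s w, ?_, ?_, fun x => ?_⟩
  · rw [← dist_eq_norm, dist_comm]
    refine (dist_map_le_dist hX _ _).trans ((hs' w).2.1.trans ?_)
    linarith
  · have hF := (contMDiff_proj hX J (X p)).continuous.tendsto (s w)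
    rw [(hs' w).1] at hF
    have hev := hF.eventually (isOpen_ball.mem_nhds (mem_ball_zero_iff.2 hwlt))
    filter_upwards [hev, (hs' w).2.2] with x hx1 hx2
    have h1 : h (s ⟨_, ball_subset_closedBall hx1⟩) ≤ h (s w) := hw (mem_univ _)
    rwa [hx2] at h1
  · have h1 := hp x
    have h5 : h (s w) = φ (s w) - η * ⟪X (s w), X (s w)⟫_ℝ -
      η * ⟪X (s w) - X p, X (s w) - X p⟫_ℝ := rfl
    have h6 := mul_nonneg hη.le (real_inner_self_nonneg (x := X (s w)))
    have h7 := mul_nonneg hη.le (real_inner_self_nonneg (x := X (s w) - X p))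
    have h8 : η * ρ ^ 2 ≤ η := mul_le_of_le_one_right hη.le (by nlinarith)
    change g x ≤ _
    linarith

/-- A nonnegative function whose penalized maxima are small vanishes. -/
theorem eq_zero_of_isLocalMax_penalized [CompleteSpace M] (hX : IsIsometricImmersion X)
    (hN : IsUnitNormal X N) {C : ℝ} (hC : 1 ≤ C) (hNC : ∀ x y, dist (N x) (N y) ≤ C * dist x y)
    {φ : M → ℝ} (hφ : Continuous φ) (hφ0 : ∀ x, 0 ≤ φ x) {B : ℝ} (hB : ∀ x, φ x ≤ B) {K : ℝ}
    (hK : ∀ (η : ℝ) (p x₀ : M), 0 < η → ‖X x₀ - X p‖ ≤ 1 →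
      IsLocalMax (fun x => φ x - η * ⟪X x, X x⟫_ℝ - η * ⟪X x - X p, X x - X p⟫_ℝ) x₀ →
      φ x₀ ≤ K * η) (x : M) : φ x = 0 := by
  refine le_antisymm (le_of_forall_pos_le_add fun ε hε => ?_) (hφ0 x)
  have : Nonempty M := ⟨x⟩
  -- Comparing x with the penalized maximum gives φ(x) ≤ (K + 1 + |X(x)|²)η, so η = ε/D suffices.
  set D := |K| + 1 + ⟪X x, X x⟫_ℝ
  have hD : 0 < D := by
    have := real_inner_self_nonneg (x := X x)
    positivity
  have hη : 0 < ε / D := by positivity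
  obtain ⟨p, x₀, h1, h2, h3⟩ := exists_isLocalMax_penalized hX hN hC hNC hφ hB hη
  have h4 := hK _ p x₀ hη h1 h2
  have h5 := h3 x
  have h6 : K * (ε / D) ≤ |K| * (ε / D) := mul_le_mul_of_nonneg_right (le_abs_self K) hη.le
  have h7 : D * (ε / D) = ε := by field_simp
  have h8 : D * (ε / D) = |K| * (ε / D) + ε / D + ε / D * ⟪X x, X x⟫_ℝ := by ring
  linarith

end Hypersurface

/-! ### Vanishing of the support function and of the shape operator. -/

section Hypersurface

open Filter Topology Set Metric Manifold

variable {n : ℕ}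

section Local

variable {M : Type*} [TopologicalSpace M] [ChartedSpace (E n) M]
  [Bundle.RiemannianBundle (fun x : M => TangentSpace (𝓡 n) x)] {X N : M → E (n + 1)}

/-- A penalized local maximum read in a graph chart. -/
theorem IsGraphAt.isLocalMax_pullback {p : M} {J : E n →L[ℝ] E (n + 1)} {f : E n → ℝ}
    {F : M → E n} {s : E n → M} (h : IsGraphAt X N p J f F s) {φ : M → ℝ} {η : ℝ} {z : E (n + 1)}
    (hmax : IsLocalMax (fun x => φ x - η * ⟪X x, X x⟫_ℝ - η * ⟪X x - z, X x - z⟫_ℝ) p)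
    {ψ : E n → ℝ} (hψ : ∀ᶠ w in 𝓝 0, φ (s w) = ψ w) :
    IsLocalMax (fun w => ψ w
      - η * sqDist f (ContinuousLinearMap.adjoint J (X p)) ⟪X p, N p⟫_ℝ w
      - η * sqDist f (ContinuousLinearMap.adjoint J (X p - z)) ⟪X p - z, N p⟫_ℝ w) 0 := by
  have h1 : IsLocalMax (fun w => φ (s w) - η * ⟪X (s w), X (s w)⟫_ℝ -
      η * ⟪X (s w) - z, X (s w) - z⟫_ℝ) 0 := by
    have h2 := h.tendsto_inv.eventually hmax
    rw [← h.inv_zero] at h2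
    simpa only [IsLocalMax, IsMaxFilter, h.inv_zero] using h2
  refine (EventuallyEq.isLocalMax_iff ?_).1 h1
  filter_upwards [hψ, h.inner_sub_sub 0, h.inner_sub_sub z] with w h2 h3 h4
  simp only [sub_zero] at h3
  rw [h2, h3, h4]

variable [IsManifold (𝓡 n) ∞ M]

/-- Transfers `support_sq_le_of_isLocalMax` to the manifold: the isometry at the base point carries
an eigenbasis of the shape operator to one of the Hessian of f. -/
theorem inner_position_normal_sq_le (hX : IsIsometricImmersion X) (hN : IsUnitNormal X N) {k : ℕ}
    (hk : k + 1 ≤ n) (hs : IsSelfShrinker (k + 1) X N)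
    (hP : ∀ x, (newton (shape X N x) k).IsPositive) {Λ : ℝ} (hΛ0 : 0 ≤ Λ)
    (hΛ : ∀ x, traceNormSq (shape X N x) ≤ Λ) {ε : ℝ} (hε : 0 < ε)
    (hPA : ∀ x, traceNormSq (sqrtEnd (newton (shape X N x) k) ∘ₗ shape X N x) ≤ k + 1 - ε)
    {η : ℝ} (hη : 0 < η) {p : M} {z : E (n + 1)} (hz : ‖X p - z‖ ≤ 1)
    (hmax : IsLocalMax (fun x => ⟪X x, N x⟫_ℝ ^ 2 - η * ⟪X x, X x⟫_ℝ -
      η * ⟪X x - z, X x - z⟫_ℝ) p) :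
    ⟪X p, N p⟫_ℝ ^ 2 ≤ (1 + 4 * (n * (2 * (1 + Λ)) ^ n) + (k + 1)) / (2 * ε) * η := by
  obtain ⟨J, f, F, s, h⟩ := exists_isGraphAt hX hN p
  obtain ⟨e, he⟩ := h.shape_base
  have hA := isSymmetric_shape hX hN p
  have hn := finrank_tangentSpace (n := n) p
  have h1 := support_sq_le_of_isLocalMax (k := k) (l := hA.eigenvalues hn)
    (b := (hA.eigenvectorBasis hn).map e) (ε := ε) (P := n * (2 * (1 + Λ)) ^ n)
    h.contDiffAt h.map_zero h.grad_zero hη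
    (h.isLocalMax_pullback hmax (ψ := fun w =>
      (supportFun f (ContinuousLinearMap.adjoint J (X p)) ⟪X p, N p⟫_ℝ w / areaFactor f w) ^ 2) ?_)
    (fun i => ?_) (by simpa using hk) (newtonValue_nonneg hA hn (hP p)) ?_ ?_ ?_ ?_
    (sum_newtonValue_le hA hn hΛ0 (hΛ p) k) ?_
  · rw [div_mul_eq_mul_div, le_div_iff₀ (by positivity)]
    linarith
  · filter_upwards [h.inner_position_normal] with w hw
    rw [hw, neg_sq]
  · rw [OrthonormalBasis.map_apply, ← he, hA.apply_eigenvectorBasis, map_smul]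
    rfl
  · filter_upwards [h.shape_conj_inv] with w ⟨e', he'⟩
    exact splits_charpoly_congr e' he' (isSymmetric_shape hX hN (s w)).splits_charpoly
  · filter_upwards [h.shape_conj_inv, h.inner_position_normal] with w ⟨e', he'⟩ hw
    rw [← sigma_congr e' he', hs, hw, neg_neg]
  · rw [← sigma_eq_esymm hA hn, hs]
  · rw [← traceNormSq_sqrt_newton_comp hA hn (hP p)]
    exact hPA p
  · have h2 := h.frame.inner_eq (X p - z) (X p - z)
    rw [← h2, real_inner_self_eq_norm_sq]
    nlinarith [norm_nonneg (X p - z)]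

theorem traceNormSq_shape_le (hX : IsIsometricImmersion X) (hN : IsUnitNormal X N)
    (h0 : ∀ x, ⟪X x, N x⟫_ℝ = 0) {η : ℝ} (hη : 0 < η) {p : M} {z : E (n + 1)}
    (hz : ‖X p - z‖ ≤ 1)
    (hmax : IsLocalMax (fun x => traceNormSq (shape X N x) - η * ⟪X x, X x⟫_ℝ -
      η * ⟪X x - z, X x - z⟫_ℝ) p) :
    traceNormSq (shape X N p) ≤ η := by
  obtain ⟨J, f, F, s, h⟩ := exists_isGraphAt hX hN p
  have hψ : ∀ᶠ w in 𝓝 0, traceNormSq (shape X N (s w)) =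
      LinearMap.trace ℝ (E n) ((fderiv ℝ (slope f) w : E n →ₗ[ℝ] E n) ∘ₗ
        (fderiv ℝ (slope f) w : E n →ₗ[ℝ] E n)) := by
    filter_upwards [h.shape_conj_inv] with w ⟨e, he⟩
    rw [traceNormSq_of_isSymmetric (isSymmetric_shape hX hN (s w))]
    exact trace_sq_congr e he
  have h1 := hψ.self_of_nhds
  rw [h.inv_zero] at h1
  rw [h1]
  refine trace_sq_le_of_isLocalMax h.contDiffAt h.map_zero h.grad_zero hη ?_
    (h.isLocalMax_pullback hmax hψ) ?_
  · filter_upwards [h.inner_position_normal] with w hw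
    rw [h0, eq_comm, neg_eq_zero, div_eq_zero_iff] at hw
    exact hw.resolve_right (areaFactor_pos f w).ne'
  · rw [real_inner_self_eq_norm_sq]
    have := h.frame.norm_adjoint_le (X p - z)
    nlinarith [norm_nonneg (ContinuousLinearMap.adjoint J (X p - z))]

end Local

section Complete

variable {M : Type*} [MetricSpace M] [ChartedSpace (E n) M]
  [Bundle.RiemannianBundle (fun x : M => TangentSpace (𝓡 n) x)] [IsRiemannianManifold (𝓡 n) M]
  {X N : M → E (n + 1)} [IsManifold (𝓡 n) ∞ M] [CompleteSpace M]

theorem inner_position_normal_eq_zero (hX : IsIsometricImmersion X) (hN : IsUnitNormal X N)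
    {k : ℕ} (hk : k + 1 ≤ n) (hs : IsSelfShrinker (k + 1) X N)
    (hP : ∀ x, (newton (shape X N x) k).IsPositive) {Λ : ℝ} (hΛ0 : 0 ≤ Λ)
    (hΛ : ∀ x, traceNormSq (shape X N x) ≤ Λ) {ε : ℝ} (hε : 0 < ε)
    (hPA : ∀ x, traceNormSq (sqrtEnd (newton (shape X N x) k) ∘ₗ shape X N x) ≤ k + 1 - ε)
    (x : M) : ⟪X x, N x⟫_ℝ = 0 := by
  refine pow_eq_zero_iff two_ne_zero |>.1 ?_
  refine eq_zero_of_isLocalMax_penalized (φ := fun x => ⟪X x, N x⟫_ℝ ^ 2) hX hN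
    (C := 1 + Λ) (by linarith) (dist_normal_le hX hN hΛ0 hΛ)
    ((hX.smooth.continuous.inner hN.continuous).pow 2) (fun x => sq_nonneg _)
    (B := ((2 * (1 + Λ)) ^ n) ^ 2) (fun x => ?_)
    (fun η p x₀ hη hp hmax => inner_position_normal_sq_le hX hN hk hs hP hΛ0 hΛ hε hPA hη hp hmax) x
  -- By the self-shrinker equation the support function inherits the bound on σ_{k+1}, although X
  -- itself may be unbounded.
  have h1 := abs_sigma_le (isSymmetric_shape hX hN x) (finrank_tangentSpace x) hΛ0 (hΛ x) (k + 1)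
  rw [hs, abs_neg] at h1
  rw [← sq_abs]
  gcongr

theorem shape_eq_zero (hX : IsIsometricImmersion X) (hN : IsUnitNormal X N)
    {Λ : ℝ} (hΛ0 : 0 ≤ Λ) (hΛ : ∀ x, traceNormSq (shape X N x) ≤ Λ)
    (h0 : ∀ x, ⟪X x, N x⟫_ℝ = 0) (x : M) : shape X N x = 0 := by
  have h : traceNormSq (shape X N x) = 0 := by
    refine eq_zero_of_isLocalMax_penalized (K := 1) hX hN (C := 1 + Λ) (by linarith)
      (dist_normal_le hX hN hΛ0 hΛ) (continuous_traceNormSq_shape hX hN) (fun x => ?_) hΛ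
      (fun η p x₀ hη hp hmax => ?_) x
    · rw [traceNormSq_eq_sum (stdOrthonormalBasis ℝ _)]
      exact Finset.sum_nonneg fun i _ => real_inner_self_nonneg
    · rw [one_mul]
      exact traceNormSq_shape_le hX hN h0 hη hp hmax
  set b := stdOrthonormalBasis ℝ (TangentSpace (𝓡 n) x)
  rw [traceNormSq_eq_sum b, Finset.sum_eq_zero_iff_of_nonneg fun i _ => real_inner_self_nonneg] at h
  refine b.toBasis.ext fun i => ?_
  rw [OrthonormalBasis.coe_toBasis, LinearMap.zero_apply]
  exact inner_self_eq_zero.1 (h i (Finset.mem_univ i))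

end Complete

end Hypersurface

/-! ### Complete hypersurfaces with constant normal. -/

section Hypersurface

open Filter Topology Set Metric Manifold

variable {n : ℕ} {M : Type*} [MetricSpace M] [ChartedSpace (E n) M]
  [Bundle.RiemannianBundle (fun x : M => TangentSpace (𝓡 n) x)] [IsRiemannianManifold (𝓡 n) M]
  {X N : M → E (n + 1)} [IsManifold (𝓡 n) ∞ M]

theorem normal_eq (hX : IsIsometricImmersion X) (hN : IsUnitNormal X N)
    (h : ∀ x, shape X N x = 0) (x y : M) : N x = N y := by
  have h1 := dist_map_le (contMDiff_normal hX hN) le_rfl (fun x v => by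
    rw [norm_differential_normal hX hN, h, LinearMap.zero_apply, norm_zero, zero_mul]) x y
  rw [zero_mul] at h1
  exact dist_le_zero.1 h1

/-- A complete hypersurface with constant normal is the graph over the whole tangent hyperplane. -/
theorem surjective_and_dist_proj_le [CompleteSpace M] [ConnectedSpace M]
    (hX : IsIsometricImmersion X) (hN : IsUnitNormal X N) {ν : E (n + 1)} (hν : ∀ x, N x = ν)
    {J : E n →L[ℝ] E (n + 1)} (hJ : IsFrame ν J) :
    Function.Surjective (fun x => ContinuousLinearMap.adjoint J (X x)) ∧
      ∀ x y, dist x y ≤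
        ‖ContinuousLinearMap.adjoint J (X x) - ContinuousLinearMap.adjoint J (X y)‖ := by
  set F : M → E n := fun x => ContinuousLinearMap.adjoint J (X x - 0) with hF
  have hFX : ∀ x, ContinuousLinearMap.adjoint J (X x) = F x := fun x => by
    simp only [hF, sub_zero]
  have hFs : ContMDiff (𝓡 n) 𝓘(ℝ, E n) ∞ F := contMDiff_proj hX J 0
  have hL : ∀ x ∈ univ, ∀ v : TangentSpace (𝓡 n) x, ‖v‖ ≤ 1 * ‖differential F x v‖ := by
    intro x _ v
    have h1 := mul_norm_le_norm_proj hX hN hJ x v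
    rw [hν, hJ.inner_self] at h1
    rw [hF, differential_proj hX]
    linarith
  have key : ∀ p : M, ∃ s : E n → M, (∀ w, F (s w) = w) ∧ (∀ w, dist p (s w) ≤ ‖w - F p‖) ∧
      ∀ x, s (F x) = x := by
    intro p
    obtain ⟨s, hs, hs'⟩ := exists_section_of_le_norm_differential hFs isOpen_univ hL (mem_univ p)
      (S := univ) fun w _ => subset_univ _
    simp only [one_mul] at hs'
    refine ⟨fun w => s ⟨w, mem_univ w⟩, fun w => (hs' _).1, fun w => (hs' _).2.1, ?_⟩
    have hc : Continuous fun x => s ⟨F x, mem_univ _⟩ :=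
      hs.comp (hFs.continuous.subtype_mk _)
    -- The section is a local inverse near its image, so its fixed set is open as well as closed;
    -- connectedness makes it a global inverse.
    have hclopen : IsClopen {x | s ⟨F x, mem_univ _⟩ = x} := by
      refine ⟨isClosed_eq hc continuous_id, isOpen_iff_mem_nhds.2 fun x hx => ?_⟩
      have h1 := (hs' ⟨F x, mem_univ _⟩).2.2
      have hx' : s ⟨F x, mem_univ _⟩ = x := hx
      rw [hx'] at h1
      filter_upwards [h1] with y hy
      exact hy (mem_univ _)
    have hp : p ∈ {x | s ⟨F x, mem_univ _⟩ = x} := by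
      have h1 := (hs' ⟨F p, mem_univ _⟩).2.1
      rw [sub_self, norm_zero] at h1
      exact (dist_le_zero.1 h1).symm
    intro x
    exact eq_univ_iff_forall.1 (hclopen.eq_univ ⟨p, hp⟩) x
  simp only [hFX]
  refine ⟨fun w => ?_, fun x y => ?_⟩
  · obtain ⟨s, hs, -⟩ := key (Classical.arbitrary M)
    exact ⟨s w, hs w⟩
  · obtain ⟨s, -, hs1, hs2⟩ := key x
    have h1 := hs1 (F y)
    rwa [hs2, norm_sub_rev] at h1

/-- X does not increase distances, and neither does the inverse of its projection to the hyperplane,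
so equality holds. The vanishing support function makes the hyperplane pass through the origin. -/
theorem isometry_and_range_eq [CompleteSpace M] [ConnectedSpace M] (hX : IsIsometricImmersion X)
    (hN : IsUnitNormal X N) {ν : E (n + 1)} (hν : ∀ x, N x = ν) (h0 : ∀ x, ⟪X x, ν⟫_ℝ = 0) :
    ∃ W : Submodule ℝ (E (n + 1)),
      Module.finrank ℝ W = n ∧ Isometry X ∧ range X = (W : Set (E (n + 1))) := by
  have hν1 : ‖ν‖ = 1 := by rw [← hν (Classical.arbitrary M), hN.norm_eq_one]
  have hν0 : ν ≠ 0 := fun h => by simp [h] at hν1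
  obtain ⟨J, hJ⟩ := exists_isFrame hν1
  obtain ⟨hsurj, hdist⟩ := surjective_and_dist_proj_le hX hN hν hJ
  have : Fact (Module.finrank ℝ (E (n + 1)) = n + 1) := ⟨by simp⟩
  refine ⟨(ℝ ∙ ν)ᗮ, Submodule.finrank_orthogonal_span_singleton hν0, Isometry.of_dist_eq fun x y =>
    le_antisymm (dist_map_le_dist hX x y) ?_, ?_⟩
  · refine (hdist x y).trans ?_
    rw [← map_sub, dist_eq_norm]
    exact hJ.norm_adjoint_le _
  · ext y
    rw [SetLike.mem_coe, Submodule.mem_orthogonal_singleton_iff_inner_left]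
    constructor
    · rintro ⟨x, rfl⟩
      exact h0 x
    · intro hy
      obtain ⟨x, hx⟩ := hsurj (ContinuousLinearMap.adjoint J y)
      refine ⟨x, ?_⟩
      have h1 := hJ.decomp (X x)
      have h2 := hJ.decomp y
      simp only at hx
      rw [h0, hx] at h1
      rw [hy] at h2
      exact h1.symm.trans h2

end Hypersurface

end SelfShrinker

end

/-! ### The main theorem. -/

theorem theorem1p2 {n r : ℕ} (hr : 1 ≤ r) (hrn : r ≤ n)
    {M : Type*} [MetricSpace M] [ConnectedSpace M] [CompleteSpace M]
    [ChartedSpace (SelfShrinker.E n) M] [IsManifold (𝓡 n) ∞ M]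
    [Bundle.RiemannianBundle (fun x : M => TangentSpace (𝓡 n) x)]
    [IsContMDiffRiemannianBundle (𝓡 n) ∞ (SelfShrinker.E n) (fun x : M => TangentSpace (𝓡 n) x)]
    [IsRiemannianManifold (𝓡 n) M]
    (X N : M → SelfShrinker.E (n + 1))
    (hX : SelfShrinker.IsIsometricImmersion X)
    (hN : SelfShrinker.IsUnitNormal X N)
    (hshrink : SelfShrinker.IsSelfShrinker r X N)
    (hP : ∀ x, (SelfShrinker.newton (SelfShrinker.shape X N x) (r - 1)).IsPositive)
    (hA : ⨆ x, ((SelfShrinker.traceNormSq (SelfShrinker.shape X N x) : ℝ) : EReal) < ⊤)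
    (hPA : ⨆ x, ((SelfShrinker.traceNormSq
        (SelfShrinker.sqrtEnd (SelfShrinker.newton (SelfShrinker.shape X N x) (r - 1)) ∘ₗ
          SelfShrinker.shape X N x) : ℝ) : EReal) < ((r : ℝ) : EReal)) :
    ∃ W : Submodule ℝ (SelfShrinker.E (n + 1)),
      Module.finrank ℝ W = n ∧ Isometry X ∧ Set.range X = (W : Set (SelfShrinker.E (n + 1))) := by
  obtain ⟨k, rfl⟩ : ∃ k, r = k + 1 := ⟨r - 1, by omega⟩
  rw [Nat.add_sub_cancel] at hPA
  simp only [Nat.add_sub_cancel] at hP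
  -- Reals strictly between the suprema and their bounds provide a uniform bound on ‖A‖² and the
  -- uniform gap ε = k + 1 - q.
  obtain ⟨Λ, hΛ, -⟩ := EReal.lt_iff_exists_real_btwn.1 hA
  obtain ⟨q, hq, hqk⟩ := EReal.lt_iff_exists_real_btwn.1 hPA
  have hΛ' : ∀ x, SelfShrinker.traceNormSq (SelfShrinker.shape X N x) ≤ max Λ 0 := fun x =>
    le_max_of_le_left (EReal.coe_le_coe_iff.1 ((le_iSup (fun x => ((SelfShrinker.traceNormSq
      (SelfShrinker.shape X N x) : ℝ) : EReal)) x).trans hΛ.le))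
  have hq' := fun x => EReal.coe_le_coe_iff.1 ((le_iSup (fun x => ((SelfShrinker.traceNormSq
    (SelfShrinker.sqrtEnd (SelfShrinker.newton (SelfShrinker.shape X N x) k) ∘ₗ
      SelfShrinker.shape X N x) : ℝ) : EReal)) x).trans hq.le)
  have hqk' : q < k + 1 := by simpa using EReal.coe_lt_coe_iff.1 hqk
  have h0 := SelfShrinker.inner_position_normal_eq_zero hX hN hrn hshrink hP (le_max_right Λ 0) hΛ'
    (ε := k + 1 - q) (by linarith) (fun x => by linarith [hq' x])
  have hS := SelfShrinker.shape_eq_zero hX hN (le_max_right Λ 0) hΛ' h0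
  have hNc := SelfShrinker.normal_eq hX hN hS
  exact SelfShrinker.isometry_and_range_eq hX hN (fun x => hNc x (Classical.arbitrary M)) fun x => by
    rw [← hNc x, h0]
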